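/- Conventions. A topos is a category equivalent to the category of sheaves of sets on a small site. A morphism of toposes (geometric morphism) $f : \mathcal{E}' \to \mathcal{E}$ is an adjoint pair $f^* \dashv f_*$, with $f^* : \mathcal{E} \to \mathcal{E}'$ and $f_* : \mathcal{E}' \to \mathcal{E}$, such that $f^*$ preserves finite limits; $\mathrm{Geom}(\mathcal{E}',\mathcal{E})$ is the category of these, a morphism $f \to g$ being a natural transformation $f^* \to g^*$. A product of toposes $\mathcal{F}_1,\dots,\mathcal{F}_n$ is a topos $\mathcal{P}$ with geometric morphisms $\pi_i : \mathcal{P} \to \mathcal{F}_i$ such that for every topos $\mathcal{E}$ the functor $\mathrm{Geom}(\mathcal{E},\mathcal{P}) \to \prod_i \mathrm{Geom}(\mathcal{E},\mathcal{F}_i)$ given by composition with the $\pi_i$ is an equivalence of categories. A topological space is called locally compact if each of its open sets $U$ is a union of open sets whose closures are compact and contained in $U$ (no separation axiom is part of "compact"). Let $X_1,\dots,X_n$ be topological spaces ($n \ge 0$). (A) Suppose that all the $X_i$, except possibly one, are locally compact. Then the canonical geometric morphism $$\mathrm{Sh}(X_1 \times \cdots \times X_n) \longrightarrow \mathrm{Sh}(X_1)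 \times \cdots \times \mathrm{Sh}(X_n)$$ induced by the projections is an equivalence. That is: $\mathrm{Sh}(X_1\times\cdots\times X_n)$, with the geometric morphisms $p_i$ to the $\mathrm{Sh}(X_i)$ defined by the projections, is a product of the toposes $\mathrm{Sh}(X_i)$; and for every product $(\mathcal{P},(\pi_i))$ of these toposes there is a geometric morphism $g : \mathrm{Sh}(X_1\times\cdots\times X_n) \to \mathcal{P}$ with $\pi_i \circ g \cong p_i$ for all $i$, and every such $g$ is an equivalence. (B) For each $i$ let $\mathcal{C}_i$ be a basis of open sets of $X_i$, regarded as a category by means of inclusion and equipped with the topology $J_i$ of usual coverings. Denote again by $J_i$ the induced topology on $\mathcal{C}_1 \times \cdots \times \mathcal{C}_n$: a sieve on $(U_1,\dots,U_n)$ is $J_i$-covering if it contains the morphisms $(U_1,\dots,U_{i-1},U_{i,k},U_{i+1},\dots,U_n) \to (U_1,\dots,U_n)$, $k \in K$, for some $J_i$-covering family $(U_{i,k} \to U_i)_{k\in K}$. Let $J$ be the topology on $\mathcal{C}_1\times\cdots\times\mathcal{C}_n$ induced by the usual coverings in the product space: a sieve on $(U_1,\dots,U_n)$ is $J$-covering if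 $U_1\times\cdots\times U_n$ is the union of the $V_1\times\cdots\times V_n$ for $(V_1,\dots,V_n)$ in the sieve. Then: 1. Restriction along $(U_1,\dots,U_n) \mapsto U_1\times\cdots\times U_n$ is an equivalence from $\mathrm{Sh}(X_1\times\cdots\times X_n)$ to the topos of $J$-sheaves on $\mathcal{C}_1\times\cdots\times\mathcal{C}_n$. 2. $J$ contains the topologies $J_1,\dots,J_n$. 3. If all the $X_i$, except possibly one, are locally compact, $J$ is generated by $J_1,\dots,J_n$, i.e. it is the smallest topology containing them. 4. If $J$ is generated by $J_1,\dots,J_n$, a family of morphisms with target $(U_1,\dots,U_n)$ is $J$-covering if and only if the maximal sieve is the only sieve on $(U_1,\dots,U_n)$ which contains the family and is $J_i$-closed for every $i$. (A sieve $S$ is $J_i$-closed if it contains every morphism $f$ to $(U_1,\dots,U_n)$ such that $f^*S$ is $J_i$-covering.) -/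

import Mathlib

open CategoryTheory TopologicalSpace

universe u

/-! ### Toposes, geometric morphisms, products of toposes -/

/-- A (Grothendieck) topos: a category equivalent to the category of sheaves of sets on a
small site. -/
def IsTopos (E : Type (u + 1)) [Category.{u} E] : Prop :=
  ∃ (C : Type u) (_ : SmallCategory C) (J : GrothendieckTopology C),
    Nonempty (E ≌ Sheaf J (Type u))

/-- Geometric morphisms `f : E ⟶ F`: adjoint pairs `f^* ⊣ f_*` with `f^* : F ⥤ E` preserving
finite limits. (Preservation of all colimits by `f^*` is automatic for a left adjoint.) -/
structure Geom (E F : Type (u + 1)) [Category.{u} E] [Category.{u} F] where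
  /-- the inverse image functor `f^*` -/
  inverseImage : F ⥤ E
  /-- the direct image functor `f_*` -/
  directImage : E ⥤ F
  /-- the adjunction `f^* ⊣ f_*` -/
  adj : inverseImage ⊣ directImage
  /-- `f^*` is left exact -/
  preservesFiniteLimits : Limits.PreservesFiniteLimits inverseImage

namespace Geom

variable {E F G : Type (u + 1)} [Category.{u} E] [Category.{u} F] [Category.{u} G]

/-- The category of geometric morphisms: a transformation `f ⟶ g` is a natural transformation
`f^* ⟶ g^*`. -/
instance : Category.{u + 1} (Geom E F) where
  Hom f g := f.inverseImage ⟶ g.inverseImage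
  id f := NatTrans.id f.inverseImage
  comp α β := NatTrans.vcomp α β

/-- The composite of `f : E ⟶ F` and `g : F ⟶ G`; its inverse image is `f^* ∘ g^*`. -/
def comp (f : Geom E F) (g : Geom F G) : Geom E G where
  inverseImage := g.inverseImage ⋙ f.inverseImage
  directImage := f.directImage ⋙ g.directImage
  adj := g.adj.comp f.adj
  preservesFiniteLimits :=
    haveI := f.preservesFiniteLimits
    haveI := g.preservesFiniteLimits
    Limits.comp_preservesFiniteLimits _ _

/-- Composition with `g : F ⟶ G`, as a functor `Geom(E, F) ⥤ Geom(E, G)`. -/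
def postcomp (E : Type (u + 1)) [Category.{u} E] (g : Geom F G) : Geom E F ⥤ Geom E G where
  obj f := f.comp g
  map {f f'} α :=
    (Functor.whiskerLeft g.inverseImage
      (show f.inverseImage ⟶ f'.inverseImage from α) :)
  map_id _ := Functor.whiskerLeft_id' g.inverseImage
  map_comp _ _ := Functor.whiskerLeft_comp g.inverseImage _ _

/-- A geometric morphism is an equivalence (an isomorphism in the 2-categorical sense) when its
inverse image functor (equivalently, its direct image functor) is an equivalence. -/
def IsEquiv (f : Geom E F) : Prop := f.inverseImage.IsEquivalence

end Geom

/-- `P`, with the geometric morphisms `π i : P ⟶ F i`, is a product of the toposes `F i` in the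
2-category of toposes: for every topos `E`, composition with the `π i` is an equivalence from
`Geom(E, P)` to the product of the categories `Geom(E, F i)`. -/
structure IsToposProduct {n : ℕ} {F : Fin n → Type (u + 1)} [∀ i, Category.{u} (F i)]
    {P : Type (u + 1)} [Category.{u} P] (π : ∀ i, Geom P (F i)) : Prop where
  isTopos : IsTopos P
  isEquivalence : ∀ (E : Type (u + 1)) [Category.{u} E], IsTopos E →
    (Functor.pi' (fun i => Geom.postcomp E (π i))).IsEquivalence

/-! ### The topos of sheaves on a space, and product spaces -/

/-- The topos of sheaves of sets on a topological space. -/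
abbrev ShTopos (X : TopCat.{u}) : Type (u + 1) := TopCat.Sheaf (Type u) X

/-- The geometric morphism `Sh(X) ⟶ Sh(Y)` defined by a continuous map `X ⟶ Y`. -/
noncomputable def geomOfContinuous {X Y : TopCat.{u}} (f : X ⟶ Y) :
    Geom (ShTopos X) (ShTopos Y) where
  inverseImage := TopCat.Sheaf.pullback (Type u) f
  directImage := TopCat.Sheaf.pushforward (Type u) f
  adj := TopCat.Sheaf.pullbackPushforwardAdjunction (Type u) f
  preservesFiniteLimits := by
    have : Limits.PreservesFiniteLimits ((Opens.map f).op.lan :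
        ((Opens Y)ᵒᵖ ⥤ Type u) ⥤ ((Opens X)ᵒᵖ ⥤ Type u)) :=
      lan_preservesFiniteLimits_of_flat (Type u) (Opens.map f)
    exact Functor.sheafPullbackConstruction.preservesFiniteLimits _ _ _ _

section Spaces

variable {n : ℕ} (X : Fin n → TopCat.{u})

/-- The product space `X₁ × ⋯ × Xₙ`. -/
abbrev prodSpace : TopCat.{u} := TopCat.of (∀ i, X i)

/-- The projections of the product space. -/
def prodSpaceProj (i : Fin n) : prodSpace X ⟶ X i :=
  TopCat.ofHom ⟨fun x => x i, continuous_apply i⟩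

/-- The geometric morphisms `Sh(X₁ × ⋯ × Xₙ) ⟶ Sh(Xᵢ)` defined by the projections. -/
noncomputable def shProj (i : Fin n) : Geom (ShTopos (prodSpace X)) (ShTopos (X i)) :=
  geomOfContinuous (prodSpaceProj X i)

end Spaces

/-- Local compactness: every open set `U` is a union of open sets whose closures are compact and
contained in `U`. -/
def IsLocCompact (X : Type u) [TopologicalSpace X] : Prop :=
  ∀ U : Set X, IsOpen U → ∃ 𝒱 : Set (Set X),
    (∀ V ∈ 𝒱, IsOpen V ∧ IsCompact (closure V) ∧ closure V ⊆ U) ∧ U = ⋃₀ 𝒱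

/-! ### Topologies on a product of categories -/

section Products

variable {n : ℕ} {C : Fin n → Type u} [∀ i, Category.{u} (C i)]

/-- Replacing the component `Uᵢ` of `U` along `f : A ⟶ Uᵢ`: there is a morphism `f' : V ⟶ U` with
component `f` at `i` (up to `V i ≅ A`), isomorphisms as other components, and through which every
`k : Z ⟶ U` whose component at `i` factors through `f` factors. -/
theorem exists_replace (U : ∀ i, C i) (i : Fin n) {A : C i} (f : A ⟶ U i) :
    ∃ (V : ∀ j, C j) (f' : V ⟶ U) (e : A ≅ V i), e.hom ≫ f' i = f ∧
      (∀ j, j ≠ i → IsIso (f' j)) ∧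
      ∀ (Z : ∀ j, C j) (k : Z ⟶ U) (c : Z i ⟶ A), k i = c ≫ f →
        ∃ l : Z ⟶ V, l ≫ f' = k ∧ l i = c ≫ e.hom := by
  refine ⟨fun j => if h : j = i then h ▸ A else U j,
    fun j => if h : j = i then eqToHom (by subst h; simp) ≫ (h ▸ f : (h ▸ A : C j) ⟶ U j)
      else eqToHom (by simp [h]), eqToIso (by simp), by simp, ?_, ?_⟩
  · intro j hj
    simp only [hj, ↓reduceDIte]
    infer_instance
  · intro Z k c hk
    refine ⟨fun j => if h : j = i then (h ▸ c : Z j ⟶ (h ▸ A : C j)) ≫ eqToHom (by subst h; simp)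
      else k j ≫ eqToHom (by simp [h]), ?_, by simp⟩
    funext j
    by_cases h : j = i
    · subst h
      simp [hk]
    · simp [h]

/-- The topology on `C₁ × ⋯ × Cₙ` induced by a topology `K` on the factor `Cᵢ`: a sieve on
`(U₁, …, Uₙ)` covers when it contains the morphisms all of whose components of index `≠ i` are
identities and whose component of index `i` runs through a `K`-covering sieve `R` of `Uᵢ`.
The sieve generated by these morphisms consists of all morphisms whose component of index `i`
is in `R`, and is written here as the pullback of `R` along the projection to `Cᵢ`
(see `functorPullback_eval_eq_generate`). -/
def factorTopology (i : Fin n) (K : GrothendieckTopology (C i)) :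
    GrothendieckTopology (∀ i, C i) where
  sieves U := {S | ∃ R ∈ K (U i), Sieve.functorPullback (Pi.eval C i) R ≤ S}
  top_mem' U := ⟨⊤, K.top_mem _, le_top⟩
  pullback_stable' := by
    rintro U V S f ⟨R, hR, h⟩
    refine ⟨R.pullback (f i), K.pullback_stable _ hR, ?_⟩
    intro W g hg
    exact h _ hg
  transitive' := by
    rintro U S ⟨R, hR, h⟩ T hT
    let M : Sieve (U i) :=
      { arrows := fun A a => ∀ (Z : ∀ j, C j) (k : Z ⟶ U) (c : Z i ⟶ A), k i = c ≫ a → T k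
        downward_closed := by
          intro A B a ha b Z k c hk
          exact ha Z k (c ≫ b) (by simpa using hk) }
    refine ⟨M, K.transitive hR M ?_, fun Z k hk => hk Z k (𝟙 _) (Category.id_comp _).symm⟩
    intro A f hf
    obtain ⟨V, f', e, he, -, hu⟩ := exists_replace U i f
    have hS : S f' := h _ (show R (f' i) by
      have : f' i = e.inv ≫ f := by rw [← he, Iso.inv_hom_id_assoc]
      rw [this]
      exact R.downward_closed hf _)
    obtain ⟨Q, hQ, hQT⟩ := hT hS
    refine K.superset_covering ?_ (K.pullback_stable e.hom hQ)
    intro B b hb Z k c hk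
    obtain ⟨l, rfl, hl⟩ := hu Z k (c ≫ b) (by simpa using hk)
    refine hQT l (show Q (l i) from ?_)
    rw [hl, Category.assoc]
    exact Q.downward_closed hb c

/-- The morphisms to `U` whose component of index `i` is in the sieve `R` form the sieve generated
by those among them whose components of index `≠ i` are invertible. -/
theorem functorPullback_eval_eq_generate (U : ∀ i, C i) (i : Fin n) (R : Sieve (U i)) :
    Sieve.functorPullback (Pi.eval C i) R =
      Sieve.generate (fun (V : ∀ i, C i) (f : V ⟶ U) => R (f i) ∧ ∀ j, j ≠ i → IsIso (f j)) := by
  apply le_antisymm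
  · intro Z k hk
    obtain ⟨V, f', e, he, hiso, hu⟩ := exists_replace U i (k i)
    obtain ⟨l, hl, -⟩ := hu Z k (𝟙 _) (by simp)
    refine ⟨V, l, f', ⟨?_, hiso⟩, hl⟩
    have : f' i = e.inv ≫ k i := by rw [← he, Iso.inv_hom_id_assoc]
    rw [this]
    exact R.downward_closed hk _
  · rw [Sieve.generate_le_iff]
    intro Z k hk
    exact hk.1

/-- The smallest topology on `C₁ × ⋯ × Cₙ` which contains the topologies induced by the
topologies `K i` of the factors. -/
def generatedTopology (K : ∀ i, GrothendieckTopology (C i)) : GrothendieckTopology (∀ i, C i) :=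
  ⨆ i, factorTopology i (K i)

end Products

/-! ### Bases of open sets -/

/-- The category (an ordered set) of the members of a set of opens of `X`. -/
abbrev BasisCat {X : TopCat.{u}} (B : Set (Opens X)) : Type u := ↥B

/-- The topology of usual coverings on a basis of open sets: a sieve on `U` covers when every point
of `U` is in the source of one of its morphisms. -/
def basisTopology {X : TopCat.{u}} {B : Set (Opens X)} (hB : Opens.IsBasis B) :
    GrothendieckTopology (BasisCat B) where
  sieves U := {S | ∀ x ∈ U.1, ∃ (V : BasisCat B) (f : V ⟶ U), S f ∧ x ∈ V.1}
  top_mem' U x hx := ⟨U, 𝟙 U, trivial, hx⟩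
  pullback_stable' := by
    intro U V S f hS x hx
    obtain ⟨W, g, hg, hxW⟩ := hS x (leOfHom f hx)
    obtain ⟨W', hW', hxW', hle⟩ :=
      Opens.isBasis_iff_nbhd.mp hB (U := V.1 ⊓ W.1) (x := x) ⟨hx, hxW⟩
    let Z : BasisCat B := ⟨W', hW'⟩
    let a : Z ⟶ V := homOfLE (show W' ≤ V.1 from hle.trans inf_le_left)
    let b : Z ⟶ W := homOfLE (show W' ≤ W.1 from hle.trans inf_le_right)
    refine ⟨Z, a, ?_, hxW'⟩
    have h : a ≫ f = b ≫ g := Subsingleton.elim _ _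
    show S (a ≫ f)
    rw [h]
    exact S.downward_closed hg b
  transitive' := by
    intro U S hS T hT x hx
    obtain ⟨V, f, hf, hxV⟩ := hS x hx
    obtain ⟨W, g, hg, hxW⟩ := hT hf x hxV
    exact ⟨W, g ≫ f, hg, hxW⟩

section Boxes

variable {n : ℕ} {X : Fin n → TopCat.{u}} (B : ∀ i, Set (Opens (X i)))

/-- The functor sending `(U₁, …, Uₙ)` to the open set `U₁ × ⋯ × Uₙ` of the product space. -/
def boxFunctor : (∀ i, BasisCat (B i)) ⥤ Opens (prodSpace X) where
  obj U := ⟨Set.univ.pi (fun i => ((U i).1 : Set (X i))),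
    isOpen_set_pi Set.finite_univ (fun i _ => (U i).1.isOpen)⟩
  map f := homOfLE (fun _ hx i hi => leOfHom (f i) (hx i hi))

variable {B}

/-- The topology on the product of the categories defined by bases of the factors which is induced
by the usual coverings in the product space: a sieve on `(U₁, …, Uₙ)` covers when every point of
`U₁ × ⋯ × Uₙ` is in one of the `V₁ × ⋯ × Vₙ` for `(V₁, …, Vₙ)` in the sieve. -/
def boxTopology (hB : ∀ i, Opens.IsBasis (B i)) : GrothendieckTopology (∀ i, BasisCat (B i)) where
  sieves U := {S | ∀ x ∈ (boxFunctor B).obj U,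
    ∃ (V : ∀ i, BasisCat (B i)) (f : V ⟶ U), S f ∧ x ∈ (boxFunctor B).obj V}
  top_mem' U x hx := ⟨U, 𝟙 U, trivial, hx⟩
  pullback_stable' := by
    intro U V S f hS x hx
    obtain ⟨W, g, hg, hxW⟩ := hS x (leOfHom ((boxFunctor B).map f) hx)
    choose W' hW' hxW' hle using fun i => Opens.isBasis_iff_nbhd.mp (hB i)
      (U := (V i).1 ⊓ (W i).1) (x := x i) ⟨hx i trivial, hxW i trivial⟩
    let Z : ∀ i, BasisCat (B i) := fun i => ⟨W' i, hW' i⟩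
    let a : Z ⟶ V := fun i => homOfLE (show W' i ≤ (V i).1 from (hle i).trans inf_le_left)
    let b : Z ⟶ W := fun i => homOfLE (show W' i ≤ (W i).1 from (hle i).trans inf_le_right)
    refine ⟨Z, a, ?_, fun i _ => hxW' i⟩
    have h : a ≫ f = b ≫ g := funext fun i => Subsingleton.elim _ _
    show S (a ≫ f)
    rw [h]
    exact S.downward_closed hg b
  transitive' := by
    intro U S hS T hT x hx
    obtain ⟨V, f, hf, hxV⟩ := hS x hx
    obtain ⟨W, g, hg, hxW⟩ := hT hf x hxV
    exact ⟨W, g ≫ f, hg, hxW⟩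

end Boxes

/-! Statement B.3 is a compactness fact, `boxTopology_eq_generatedTopology`. Let a sieve on a box U
cover it pointwise and be closed for every factor topology. By the tube lemma
`exists_box_mem_of_isCompact` it contains boxes with prescribed relatively compact components at the
locally compact indices. Closedness in the one remaining direction frees the last component, and
closedness in each locally compact direction then removes relative compactness, since relatively
compact basic opens cover. So the sieve is maximal. B.4 is a formal closure argument, and B.1 is the
comparison lemma, boxes being a basis of the product.

Statement A follows from B.3 for the bases of all open sets, because sheaf toposes of spaces are
localic. A geometric morphism E → Sh(Y) is determined by the inverse images of the opens of Y, which
are subterminal, and Geom(E, Sh(Y)) is thin. For E = Sh(C, K) one such morphism amounts to a map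
from opens of Y to `LocalSet K` preserving finite intersections and coverings (`IsLexCover`). Given
such maps F i for the factors, send an open U of the product to the objects that lie locally in all
F i (V i) for some box V inside U. Each F i respects coverings of its own factor; as these generate
all coverings of boxes, the new map respects coverings (`exists_isLexCover_prod`). -/

/-! ### Topologies generated by a family, through closed sieves. -/

section GeneratedTopology

/-- A topology for which a sieve covers when, stably under pullback, the only sieve that contains
it and is closed for all topologies of a given family is the maximal one. -/
def closedTopology {D : Type*} [Category* D] {ι : Sort*} (J : ι → GrothendieckTopology D) :
    GrothendieckTopology D where
  sieves U := {T | ∀ (V : D) (g : V ⟶ U) (S : Sieve V), (∀ i, (J i).IsClosed S) →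
    T.pullback g ≤ S → S = ⊤}
  top_mem' U V g S _ h := by simpa using h
  pullback_stable' := by
    intro U V T f hT W g S hS h
    exact hT W (g ≫ f) S hS (by rwa [Sieve.pullback_comp])
  transitive' := by
    intro U T hT R hR V g S hS h
    refine hT V g S hS fun W f hf => ?_
    have := hR hf W (𝟙 W) (S.pullback f) (fun i => (J i).isClosed_pullback f S (hS i)) (by
      rw [Sieve.pullback_id, Sieve.pullback_comp]
      exact Sieve.pullback_monotone f h)
    exact Sieve.mem_iff_pullback_eq_top f |>.mpr this

/-- A `J i`-closed sieve is its own `J i`-closure, and this closure is maximal once the sieve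
contains a `J i`-covering one. -/
theorem le_closedTopology {D : Type*} [Category* D] {ι : Sort*} (J : ι → GrothendieckTopology D)
    (i : ι) : J i ≤ closedTopology J := by
  intro U T hT V g S hS h
  rw [← (J i).close_eq_self_of_isClosed (hS i), (J i).close_eq_top_iff_mem]
  exact (J i).superset_covering h ((J i).pullback_stable g hT)

/-- A family covers for the topology generated by a family of topologies if and only if the
maximal sieve is the only sieve containing it which is closed for each of these topologies. -/
theorem mem_iSup_iff_forall_isClosed {D : Type*} [Category* D] {ι : Sort*}
    (J : ι → GrothendieckTopology D) {U : D} (R : Presieve U) :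
    Sieve.generate R ∈ (⨆ i, J i) U ↔
      ∀ S : Sieve U, R ≤ S.arrows → (∀ i, (J i).IsClosed S) → S = ⊤ := by
  constructor
  · intro hR S hRS hS
    have := (iSup_le (le_closedTopology J) : _ ≤ closedTopology J) U hR
    exact this U (𝟙 U) S hS (by simpa [Sieve.generate_le_iff] using hRS)
  · intro h
    rw [← GrothendieckTopology.close_eq_top_iff_mem]
    -- Test on the closure of `R` for the supremum: being closed for the supremum, it is closed for
    -- each smaller topology `J i`.
    refine h _ ((Sieve.le_generate R).trans
      ((⨆ i, J i).le_close (Sieve.generate R))) fun i V f hf => ?_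
    exact (⨆ i, J i).close_isClosed _ f (le_iSup J i V hf)

end GeneratedTopology

/-! ### Tube lemma and generation of the box topology. -/

section BoxTopology

variable {n : ℕ} {X : Fin n → TopCat.{u}} {B : ∀ i, Set (Opens (X i))}

theorem exists_update_mem {U : ∀ i, BasisCat (B i)} {i : Fin n} (R : Sieve (U i))
    {W : BasisCat (B i)} (f : W ⟶ U i) (hf : R f) :
    ∃ (V : ∀ i, BasisCat (B i)) (g : V ⟶ U), R (g i) ∧ V i = W ∧ ∀ j, j ≠ i → V j = U j := by
  let V : ∀ j, BasisCat (B j) := Function.update U i W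
  have hV : ∀ j, V j ≤ U j := fun j => by
    by_cases hj : j = i
    · subst hj; simpa [V] using leOfHom f
    · simp [V, hj]
  have e : V i = W := by simp [V]
  refine ⟨V, fun j => homOfLE (hV j), ?_, e, fun j hj => by simp [V, hj]⟩
  convert R.downward_closed hf (eqToHom e) using 1
  exact Subsingleton.elim _ _

theorem factorTopology_le_boxTopology (hB : ∀ i, Opens.IsBasis (B i)) (i : Fin n) :
    factorTopology i (basisTopology (hB i)) ≤ boxTopology hB := by
  rintro U S ⟨R, hR, h⟩ x hx
  obtain ⟨W, f, hf, hxW⟩ := hR (x i) (hx i trivial)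
  obtain ⟨V, g, hg, hVi, hVj⟩ := exists_update_mem R f hf
  refine ⟨V, g, h _ hg, fun j _ => ?_⟩
  change x j ∈ (V j).1
  by_cases hj : j = i
  · subst hj; rwa [hVi]
  · rw [hVj j hj]; exact hx j trivial

/-- In a locally compact space, a basis contains small neighbourhoods with compact closure. -/
theorem IsLocCompact.exists_mem_basis {Y : TopCat.{u}} (hY : IsLocCompact Y) {B : Set (Opens Y)}
    (hB : Opens.IsBasis B) {U : Opens Y} {x : Y} (hx : x ∈ U) :
    ∃ W ∈ B, x ∈ W ∧ IsCompact (closure (W : Set Y)) ∧ closure (W : Set Y) ⊆ U := by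
  obtain ⟨𝒱, h𝒱, hU⟩ := hY U U.isOpen
  have hx' : x ∈ ⋃₀ 𝒱 := hU ▸ hx
  obtain ⟨V, hV, hxV⟩ := hx'
  obtain ⟨hVo, hVc, hVU⟩ := h𝒱 V hV
  obtain ⟨W, hW, hxW, hWV⟩ := Opens.isBasis_iff_nbhd.mp hB (U := ⟨V, hVo⟩) (x := x) hxV
  have : closure (W : Set Y) ⊆ closure V := closure_mono hWV
  exact ⟨W, hW, hxW, hVc.of_isClosed_subset isClosed_closure this, this.trans hVU⟩

/-- Closedness in one direction, in usable form: a box belongs to `S` as soon as its `i`-th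
component is covered by opens over which all smaller boxes belong to `S`. Those opens form the sieve
`R`. -/
theorem mem_of_factor_cover (hB : ∀ i, Opens.IsBasis (B i)) {U : ∀ i, BasisCat (B i)} {S : Sieve U}
    (i : Fin n) (hS : (factorTopology i (basisTopology (hB i))).IsClosed S)
    (V : ∀ i, BasisCat (B i)) (hV : V ≤ U)
    (h : ∀ x ∈ (V i).1, ∃ W : BasisCat (B i), x ∈ W.1 ∧ W ≤ V i ∧
      ∀ (W' : ∀ j, BasisCat (B j)) (hW' : W' ≤ V), W' i ≤ W →
        S (fun j => homOfLE ((hW'.trans hV) j))) :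
    S (fun j => homOfLE (hV j)) := by
  apply hS
  let R : Sieve (V i) :=
    { arrows := fun W _ => ∀ (W' : ∀ j, BasisCat (B j)) (hW' : W' ≤ V), W' i ≤ W →
        S (fun j => homOfLE ((hW'.trans hV) j))
      downward_closed := fun hW g W' hW' hle => hW W' hW' (hle.trans (leOfHom g)) }
  refine ⟨R, fun x hx => ?_, fun W' g hg => ?_⟩
  · obtain ⟨W, hxW, hWV, hW⟩ := h x hx
    exact ⟨W, homOfLE hWV, hW, hxW⟩
  · exact hg W' (fun j => leOfHom (g j)) le_rfl

/-- The tube lemma for sieves on boxes: if `S` covers pointwise and is closed for the topologies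
induced by the factors, then it contains boxes whose components in a given set of indices are
prescribed relatively compact open sets. -/
theorem exists_box_mem_of_isCompact (hB : ∀ i, Opens.IsBasis (B i)) {U : ∀ i, BasisCat (B i)}
    {S : Sieve U} (hS : ∀ i, (factorTopology i (basisTopology (hB i))).IsClosed S)
    (hcov : S ∈ boxTopology hB U) (W : ∀ i, BasisCat (B i)) (T : Finset (Fin n))
    (hW : ∀ i ∈ T, IsCompact (closure ((W i).1 : Set (X i))) ∧
      closure ((W i).1 : Set (X i)) ⊆ (U i).1)
    (x : ∀ i, X i) (hx : ∀ i, x i ∈ (U i).1) :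
    ∃ (V : ∀ i, BasisCat (B i)) (hV : V ≤ U), S (fun j => homOfLE (hV j)) ∧
      (∀ i ∈ T, V i = W i) ∧ ∀ j, j ∉ T → x j ∈ (V j).1 := by
  induction T using Finset.induction_on generalizing x with
  | empty =>
    obtain ⟨V, f, hf, hxV⟩ := hcov x (fun i _ => hx i)
    exact ⟨V, fun j => leOfHom (f j), hf, by simp, fun j _ => hxV j trivial⟩
  | insert a T ha ih =>
    obtain ⟨hK, hKU⟩ := hW a (Finset.mem_insert_self a T)
    -- Induction with the coordinate `x a` moved to `z`; the moved point stays in `U` because the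
    -- whole closure of `W a` lies in `U a`.
    have key : ∀ z : closure ((W a).1 : Set (X a)), ∃ (V : ∀ i, BasisCat (B i)) (hV : V ≤ U),
        S (fun j => homOfLE (hV j)) ∧ (∀ i ∈ T, V i = W i) ∧ (z : X a) ∈ (V a).1 ∧
        ∀ j, j ∉ insert a T → x j ∈ (V j).1 := by
      intro z
      obtain ⟨V, hV, hSV, hT, hj⟩ := ih (fun i hi => hW i (Finset.mem_insert_of_mem hi))
        (Function.update x a z) (fun i => by
          by_cases h : i = a
          · subst h; simpa using hKU z.2
          · simpa [h] using hx i)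
      refine ⟨V, hV, hSV, hT, by simpa using hj a ha, fun j hjT => ?_⟩
      rw [Finset.mem_insert, not_or] at hjT
      simpa [hjT.1] using hj j hjT.2
    choose V hVU hSV hVT hVa hVj using key
    obtain ⟨t, ht⟩ := hK.elim_finite_subcover (fun z => ((V z a).1 : Set (X a)))
      (fun z => (V z a).1.isOpen) (fun z hz => Set.mem_iUnion.mpr ⟨⟨z, hz⟩, hVa ⟨z, hz⟩⟩)
    -- The tube: prescribed components on `insert a T`, and elsewhere a neighbourhood of `x j`
    -- inside the finitely many `V z j` with `z ∈ t`.
    have hN : ∀ j, ∃ N : BasisCat (B j), (j ∈ insert a T → N = W j) ∧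
        (j ∉ insert a T → x j ∈ N.1 ∧ N ≤ U j ∧ ∀ z ∈ t, N ≤ V z j) := by
      intro j
      by_cases hj : j ∈ insert a T
      · exact ⟨W j, fun _ => rfl, fun h => absurd hj h⟩
      · have hmem : x j ∈ (U j).1 ⊓ t.inf (fun z => (V z j).1) := by
          refine ⟨hx j, ?_⟩
          rw [SetLike.mem_coe, ← SetLike.mem_coe, Opens.coe_finset_inf, Finset.inf_eq_iInf]
          simp only [Set.iInf_eq_iInter, Set.mem_iInter]
          exact fun z _ => hVj z j hj
        obtain ⟨N, hNB, hxN, hle⟩ := Opens.isBasis_iff_nbhd.mp (hB j) hmem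
        exact ⟨⟨N, hNB⟩, fun h => absurd h hj, fun _ => ⟨hxN, hle.trans inf_le_left,
          fun z hz => hle.trans (inf_le_right.trans (Finset.inf_le hz))⟩⟩
    choose N hN₁ hN₂ using hN
    have hNU : N ≤ U := fun j => by
      by_cases hj : j ∈ insert a T
      · rw [hN₁ j hj]
        exact subset_closure.trans (hW j hj).2
      · exact (hN₂ j hj).2.1
    refine ⟨N, hNU, ?_, hN₁, fun j hj => (hN₂ j hj).1⟩
    -- The opens `V z a`, `z ∈ t`, cover `W a`; over each of them the tube lies in the box `V z`,
    -- which is in `S`.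
    refine mem_of_factor_cover hB a (hS a) N hNU fun y hy => ?_
    have hya : y ∈ (W a).1 := by rwa [← hN₁ a (Finset.mem_insert_self a T)]
    obtain ⟨z, hzt, hyz⟩ := Set.mem_iUnion₂.mp (ht (subset_closure hya))
    obtain ⟨Q, hQB, hyQ, hQ⟩ := Opens.isBasis_iff_nbhd.mp (hB a)
      (U := (V z a).1 ⊓ (N a).1) (x := y) ⟨hyz, hy⟩
    refine ⟨⟨Q, hQB⟩, hyQ, hQ.trans inf_le_right, fun W' hW' hle => ?_⟩
    have hWV : W' ≤ V z := fun j => by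
      by_cases hja : j = a
      · subst hja
        exact hle.trans (hQ.trans inf_le_left)
      · by_cases hj : j ∈ T
        · rw [hVT z j hj, ← hN₁ j (Finset.mem_insert_of_mem hj)]
          exact hW' j
        · exact (hW' j).trans ((hN₂ j (by simp [hja, hj])).2.2 z hzt)
    exact S.downward_closed (hSV z) (fun j => homOfLE (hWV j))

theorem boxTopology_eq_generatedTopology (hB : ∀ i, Opens.IsBasis (B i))
    (hX : ∀ i j : Fin n, ¬ IsLocCompact (X i) → ¬ IsLocCompact (X j) → i = j) :
    boxTopology hB = generatedTopology (fun i => basisTopology (hB i)) := by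
  refine le_antisymm (fun U S₀ hcov₀ => ?_) (iSup_le (factorTopology_le_boxTopology hB))
  rw [← Sieve.generate_sieve S₀]
  refine (mem_iSup_iff_forall_isClosed _ _).mpr fun S hS₀ hS => ?_
  have hcov : S ∈ boxTopology hB U := (boxTopology hB).superset_covering hS₀ hcov₀
  have down : ∀ {V W : ∀ i, BasisCat (B i)} (hV : V ≤ U) (hWV : W ≤ V),
      S (fun j => homOfLE (hV j)) → S (fun j => homOfLE ((hWV.trans hV) j)) :=
    fun hV hWV h => S.downward_closed h (fun j => homOfLE (hWV j))
  suffices S (fun j => homOfLE (le_refl (U j))) from Sieve.id_mem_iff_eq_top.mp this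
  -- An empty component is covered by the empty family of its factor. Otherwise `U` has a point,
  -- which the tube lemma needs.
  by_cases hne : ∃ i, ∀ x, x ∉ (U i).1
  · obtain ⟨i, hi⟩ := hne
    exact mem_of_factor_cover hB i (hS i) U le_rfl fun x hx => absurd hx (hi x)
  push Not at hne
  choose x hx using hne
  let good (i : Fin n) (V : BasisCat (B i)) : Prop :=
    IsCompact (closure (V.1 : Set (X i))) ∧ closure (V.1 : Set (X i)) ⊆ (U i).1
  have good_mono : ∀ {i} {V W : BasisCat (B i)}, W ≤ V → good i V → good i W :=
    fun {i V W} hWV hV => by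
      have : closure (W.1 : Set (X i)) ⊆ closure (V.1 : Set (X i)) := closure_mono hWV
      exact ⟨hV.1.of_isClosed_subset isClosed_closure this, this.trans hV.2⟩
  -- With all locally compact components relatively compact, the tube lemma prescribes them all and
  -- leaves at most one index `i`. As `y` runs through `V i`, the boxes found agree with `V` off `i`
  -- and cover `V i`, so closedness in direction `i` applies.
  have base : ∀ (V : ∀ i, BasisCat (B i)) (hV : V ≤ U),
      (∀ i, IsLocCompact (X i) → good i (V i)) → S (fun j => homOfLE (hV j)) := by
    classical
    intro V hV hgood
    have tube := exists_box_mem_of_isCompact hB hS hcov V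
      (Finset.univ.filter fun i => IsLocCompact (X i)) (fun i hi => hgood i (by simpa using hi))
    by_cases hex : ∃ i, ¬ IsLocCompact (X i)
    · obtain ⟨i, hi⟩ := hex
      refine mem_of_factor_cover hB i (hS i) V hV fun y hy => ?_
      obtain ⟨N, hNU, hSN, hN, hyN⟩ := tube (Function.update x i y) (fun j => by
        by_cases h : j = i
        · subst h; simpa using hV _ hy
        · simpa [h] using hx j)
      have hyN' : y ∈ (N i).1 := by simpa using hyN i (by simpa using hi)
      obtain ⟨Q, hQB, hyQ, hQ⟩ := Opens.isBasis_iff_nbhd.mp (hB i)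
        (U := (N i).1 ⊓ (V i).1) (x := y) ⟨hyN', hy⟩
      refine ⟨⟨Q, hQB⟩, hyQ, hQ.trans inf_le_right, fun W' hW' hle => ?_⟩
      refine down hNU (fun j => ?_) hSN
      by_cases hj : IsLocCompact (X j)
      · rw [hN j (by simpa using hj)]
        exact hW' j
      · obtain rfl := hX i j hi hj
        exact hle.trans (hQ.trans inf_le_left)
    · push Not at hex
      obtain ⟨N, hNU, hSN, hN, -⟩ := tube x hx
      obtain rfl : N = V := funext fun j => hN j (by simpa using hex j)
      exact hSN
  -- `T` is the set of indices where relative compactness is no longer required. An index is added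
  -- by covering its component with relatively compact basic opens.
  have step : ∀ (T : Finset (Fin n)) (V : ∀ i, BasisCat (B i)) (hV : V ≤ U),
      (∀ i ∉ T, IsLocCompact (X i) → good i (V i)) → S (fun j => homOfLE (hV j)) := by
    intro T
    induction T using Finset.induction_on with
    | empty => exact fun V hV hg => base V hV fun i => hg i (Finset.notMem_empty i)
    | insert a T ha ih =>
      intro V hV hg
      by_cases hla : IsLocCompact (X a)
      · refine mem_of_factor_cover hB a (hS a) V hV fun y hy => ?_
        obtain ⟨W, hWB, hyW, hWc, hWV⟩ := hla.exists_mem_basis (hB a) hy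
        refine ⟨⟨W, hWB⟩, hyW, subset_closure.trans hWV, fun W' hW' hle =>
          ih W' (hW'.trans hV) fun i hi hli => ?_⟩
        by_cases hia : i = a
        · subst hia
          exact good_mono hle ⟨hWc, hWV.trans (hV _)⟩
        · exact good_mono (hW' i) (hg i (by simp [hia, hi]) hli)
      · refine ih V hV fun i hi hli => hg i ?_ hli
        rw [Finset.mem_insert, not_or]
        exact ⟨fun h => hla (h ▸ hli), hi⟩
  exact step Finset.univ U le_rfl fun i hi => absurd (Finset.mem_univ i) hi

end BoxTopology

/-! ### Sheaves on the product space as sheaves on boxes. -/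

section BoxSheaves

variable {n : ℕ} {X : Fin n → TopCat.{u}} {B : ∀ i, Set (Opens (X i))}

theorem exists_box_nhd (hB : ∀ i, Opens.IsBasis (B i)) {U : Opens (prodSpace X)}
    {x : prodSpace X} (hx : x ∈ U) :
    ∃ V : ∀ i, BasisCat (B i), x ∈ (boxFunctor B).obj V ∧ (boxFunctor B).obj V ≤ U := by
  obtain ⟨u, hu, huU⟩ := isOpen_pi_iff'.mp U.isOpen x hx
  choose V hV hxV hle using fun i => Opens.isBasis_iff_nbhd.mp (hB i)
    (U := ⟨u i, (hu i).1⟩) (x := x i) (hu i).2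
  exact ⟨fun i => ⟨V i, hV i⟩, fun i _ => hxV i,
    fun y hy => huU fun i hi => hle i (hy i hi)⟩

theorem exists_box_nhd_le (hB : ∀ i, Opens.IsBasis (B i)) {U : ∀ i, BasisCat (B i)}
    {U' : Opens (prodSpace X)} {x : prodSpace X} (hx : x ∈ (boxFunctor B).obj U) (hx' : x ∈ U') :
    ∃ V : ∀ i, BasisCat (B i), x ∈ (boxFunctor B).obj V ∧ V ≤ U ∧ (boxFunctor B).obj V ≤ U' := by
  obtain ⟨W, hxW, hWU⟩ := exists_box_nhd hB hx'
  choose V hV hxV hle using fun i => Opens.isBasis_iff_nbhd.mp (hB i)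
    (U := (U i).1 ⊓ (W i).1) (x := x i) ⟨hx i trivial, hxW i trivial⟩
  exact ⟨fun i => ⟨V i, hV i⟩, fun i _ => hxV i, fun i => (hle i).trans inf_le_left,
    fun y hy => hWU fun i hi => ((hle i).trans inf_le_right) (hy i hi)⟩

theorem boxFunctor_isDenseSubsite (hB : ∀ i, Opens.IsBasis (B i)) :
    (boxFunctor B).IsDenseSubsite (boxTopology hB) (Opens.grothendieckTopology (prodSpace X)) where
  isCoverDense' := ⟨fun U x hx => by
    obtain ⟨V, hxV, hV⟩ := exists_box_nhd hB hx
    exact ⟨_, homOfLE hV, Presieve.in_coverByImage _ _, hxV⟩⟩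
  -- Full only locally: a box with an empty component lies in every box, without componentwise
  -- inclusions. Around an actual point, intersecting components repairs this.
  isLocallyFull' := ⟨fun {U V} f x hx => by
    choose Q hQ hxQ hle using fun i => Opens.isBasis_iff_nbhd.mp (hB i)
      (U := (U i).1 ⊓ (V i).1) (x := x i) ⟨hx i trivial, leOfHom f hx i trivial⟩
    let P : ∀ i, BasisCat (B i) := fun i => ⟨Q i, hQ i⟩
    let g : P ⟶ U := fun i => homOfLE ((hle i).trans inf_le_left)
    let k : P ⟶ V := fun i => homOfLE ((hle i).trans inf_le_right)
    exact ⟨(boxFunctor B).obj P, (boxFunctor B).map g,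
      Presieve.image_mem_functorPushforward _ _ ⟨k, Subsingleton.elim _ _⟩, fun i _ => hxQ i⟩⟩
  isLocallyFaithful' := ⟨fun {U V} f₁ f₂ _ => by
    obtain rfl : f₁ = f₂ := funext fun i => Subsingleton.elim _ _
    rw [Sieve.equalizer_self, Sieve.functorPushforward_top]
    exact GrothendieckTopology.top_mem _ _⟩
  functorPushforward_mem_iff := by
    intro U S
    constructor
    · intro h x hx
      obtain ⟨W, f, ⟨V, g, k, hg, -⟩, hxW⟩ := h x hx
      exact ⟨V, g, hg, leOfHom k hxW⟩
    · intro h x hx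
      obtain ⟨V, f, hf, hxV⟩ := h x hx
      exact ⟨_, (boxFunctor B).map f, Presieve.image_mem_functorPushforward _ _ hf, hxV⟩

theorem exists_sheaf_box_equivalence (hB : ∀ i, Opens.IsBasis (B i)) :
    ∃ e : ShTopos (prodSpace X) ≌ Sheaf (boxTopology hB) (Type u),
      Nonempty (e.functor ⋙ sheafToPresheaf (boxTopology hB) (Type u) ≅
        sheafToPresheaf (Opens.grothendieckTopology (prodSpace X)) (Type u) ⋙
          (Functor.whiskeringLeft _ _ _).obj (boxFunctor B).op) := by
  have := boxFunctor_isDenseSubsite hB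
  exact ⟨(Functor.IsDenseSubsite.sheafEquiv (boxTopology hB)
    (Opens.grothendieckTopology (prodSpace X)) (boxFunctor B) (Type u)).symm, ⟨Iso.refl _⟩⟩

end BoxSheaves

open Opposite Limits

/-! ### Subterminal sheaves and opens as representable sheaves. -/

section Subterminal

variable {C : Type u} [SmallCategory C] {K : GrothendieckTopology C}

/-- Sections over `c` are morphisms from the sheaf associated to the presheaf represented by `c`. -/
noncomputable def sectionEquiv (e : Sheaf K (Type u)) (c : C) :
    ((presheafToSheaf K (Type u)).obj (yoneda.obj c) ⟶ e) ≃ e.obj.obj (op c) :=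
  ((sheafificationAdjunction K (Type u)).homEquiv (yoneda.obj c) e).trans yonedaEquiv

theorem subsingleton_of_isSubterminal {e : Sheaf K (Type u)} (he : IsSubterminal e) (c : C) :
    Subsingleton (e.obj.obj (op c)) :=
  (sectionEquiv e c).symm.subsingleton_congr.mpr ⟨fun a b => he a b⟩

theorem isSubterminal_of_subsingleton {e : Sheaf K (Type u)}
    (he : ∀ c : C, Subsingleton (e.obj.obj (op c))) : IsSubterminal e := fun Z f g => by
  ext c x
  exact (he c.unop).elim _ _

theorem nonempty_hom_of_subsingleton {P Q : Cᵒᵖ ⥤ Type u}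
    (hQ : ∀ c : C, Subsingleton (Q.obj (op c)))
    (h : ∀ c : C, P.obj (op c) → Nonempty (Q.obj (op c))) : Nonempty (P ⟶ Q) :=
  ⟨{ app := fun c => ↾fun x => (h c.unop x).some
     naturality := fun c d f => by
      ext x
      exact (hQ d.unop).elim _ _ }⟩

/-- A sheaf with at most one section on each object has a section on an object as soon as it has
sections locally. -/
theorem nonempty_of_cover {e : Sheaf K (Type u)}
    (he : ∀ c : C, Subsingleton (e.obj.obj (op c))) {c : C} {T : Sieve c} (hT : T ∈ K c)
    (h : ∀ ⦃d : C⦄ (f : d ⟶ c), T f → Nonempty (e.obj.obj (op d))) :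
    Nonempty (e.obj.obj (op c)) := by
  have hsh := (isSheaf_iff_isSheaf_of_type _ _).mp e.property T hT
  exact ⟨hsh.amalgamate (fun d f hf => (h f hf).some)
    (fun _ _ Z _ _ _ _ _ _ _ => (he Z).elim _ _)⟩

end Subterminal

instance Opens.subcanonical_grothendieckTopology (Y : Type u) [TopologicalSpace Y] :
    (Opens.grothendieckTopology Y).Subcanonical :=
  .of_isSheaf_yoneda_obj _ fun U V S hS x hx => by
    have := fun W : Opens Y => (inferInstance : Subsingleton (W ⟶ U))
    have hle : V ≤ U := fun y hy => by
      obtain ⟨W, f, hf, hyW⟩ := hS y hy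
      exact leOfHom (x f hf) hyW
    exact ⟨homOfLE hle, fun _ _ _ => (this _).elim _ _, fun _ _ => (this _).elim _ _⟩

/-- The topos of sheaves on `Y`, as the category of sheaves for the topology of open coverings. -/
abbrev OpenTopos (Y : TopCat.{u}) : Type (u + 1) :=
  Sheaf (Opens.grothendieckTopology Y) (Type u)

/-- The sheaf on `Y` represented by an open set. -/
abbrev openSheaf {Y : TopCat.{u}} (U : Opens Y) : OpenTopos Y :=
  (Opens.grothendieckTopology Y).yoneda.obj U

theorem isSubterminal_openSheaf {Y : TopCat.{u}} (U : Opens Y) : IsSubterminal (openSheaf U) :=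
  isSubterminal_of_subsingleton fun V => inferInstanceAs (Subsingleton (V ⟶ U))

theorem CategoryTheory.IsSubterminal.map {E F : Type*} [Category* E] [Category* F] [HasTerminal E]
    (G : E ⥤ F) [PreservesFiniteLimits G] {e : E} (he : IsSubterminal e) : IsSubterminal (G.obj e) := by
  have := he.mono_terminal_from
  have hT : IsTerminal (G.obj (⊤_ E)) := terminalIsTerminal.isTerminalObj G _
  have : Mono (hT.from (G.obj e)) := by
    rw [hT.hom_ext (hT.from (G.obj e)) (G.map (terminal.from e))]
    infer_instance
  exact isSubterminal_of_mono_isTerminal_from hT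

/-! ### Geometric morphisms to Sh(Y) are controlled by open sets. -/

namespace Geom

variable {E : Type (u + 1)} [Category.{u} E] {Y : TopCat.{u}}

/-- Morphisms from the inverse image of an open set are sections of the direct image. -/
noncomputable def openEquiv (f : Geom E (OpenTopos Y)) (U : Opens Y) (e : E) :
    (f.inverseImage.obj (openSheaf U) ⟶ e) ≃ (f.directImage.obj e).obj.obj (op U) :=
  (f.adj.homEquiv _ _).trans (Opens.grothendieckTopology Y).yonedaEquiv

theorem isSubterminal_inverseImage_openSheaf (f : Geom E (OpenTopos Y)) (U : Opens Y) :
    IsSubterminal (f.inverseImage.obj (openSheaf U)) :=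
  have := f.preservesFiniteLimits
  (isSubterminal_openSheaf U).map f.inverseImage

theorem subsingleton_sections (f : Geom E (OpenTopos Y)) {e : E} (he : IsSubterminal e)
    (U : Opens Y) : Subsingleton ((f.directImage.obj e).obj.obj (op U)) :=
  (f.openEquiv U e).symm.subsingleton_congr.mpr ⟨fun a b => he a b⟩

/-- The category of geometric morphisms to the topos of sheaves on a space is thin. -/
instance quiver_isThin : Quiver.IsThin (Geom E (OpenTopos Y)) := fun f g => ⟨fun α β => by
  suffices ∀ G, α.app G = β.app G from NatTrans.ext (funext this)
  intro G
  -- After transposition the maps start from `G`, so sections `p` over opens `U` detect equality.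
  -- Naturality along `p` reduces to two maps into the subterminal inverse image of `U` under `g`.
  apply (f.adj.homEquiv _ _).injective
  apply (Opens.grothendieckTopology Y).hom_ext_yoneda
  intro U p
  rw [← f.adj.homEquiv_naturality_left, ← f.adj.homEquiv_naturality_left]
  congr 1
  have hα := NatTrans.naturality (F := f.inverseImage) (G := g.inverseImage) α p
  have hβ := NatTrans.naturality (F := f.inverseImage) (G := g.inverseImage) β p
  exact hα.trans ((congrArg (· ≫ _) (g.isSubterminal_inverseImage_openSheaf U _ _)).trans hβ.symm)⟩

/-- A transformation between geometric morphisms to the topos of sheaves on a space exists as soon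
as it exists on open sets. -/
theorem nonempty_hom (f g : Geom E (OpenTopos Y))
    (h : ∀ U, Nonempty (f.inverseImage.obj (openSheaf U) ⟶ g.inverseImage.obj (openSheaf U))) :
    Nonempty (f ⟶ g) := by
  have hsub := fun U V => f.subsingleton_sections (g.isSubterminal_inverseImage_openSheaf U) V
  let J := Opens.grothendieckTopology Y
  -- `t U` is the section over `U` that transposes the given map. A section `s : U → G` goes to the
  -- image of `t U` under `M.map s`; restrictions are respected because `M` of an open set has at
  -- most one section anywhere. Transposing `φ` back gives the transformation.
  let t := fun U => f.openEquiv U _ (h U).some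
  let M : OpenTopos Y ⥤ OpenTopos Y := g.inverseImage ⋙ f.directImage
  let φ : ∀ G : OpenTopos Y, G ⟶ M.obj G := fun G => ⟨{
    app := fun U => ↾fun s => (M.map (J.yonedaEquiv.symm s)).hom.app U (t U.unop)
    naturality := fun U V i => by
      ext s
      have h₁ : J.yonedaEquiv.symm (G.obj.map i s) =
        J.yoneda.map i.unop ≫ J.yonedaEquiv.symm s := J.yonedaEquiv_symm_map i s
      have h₂ : (M.map (J.yoneda.map i.unop)).hom.app V (t V.unop) =
        (M.obj (openSheaf U.unop)).obj.map i (t U.unop) := (hsub _ _).elim _ _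
      have h₃ := NatTrans.naturality_apply (M.map (J.yonedaEquiv.symm s)).hom i (t U.unop)
      change (M.map (J.yonedaEquiv.symm (G.obj.map i s))).hom.app V (t V.unop) = _
      rw [h₁, M.map_comp]
      exact (congrArg _ h₂).trans h₃ }⟩
  have hφ : ∀ {G G' : OpenTopos Y} (m : G ⟶ G'), m ≫ φ G' = φ G ≫ M.map m := by
    intro G G' m
    ext U s
    have h₁ := J.yonedaEquiv_symm_naturality_right U.unop m s
    change (M.map (J.yonedaEquiv.symm (m.hom.app U s))).hom.app U (t U.unop) =
      (M.map m).hom.app U ((M.map (J.yonedaEquiv.symm s)).hom.app U (t U.unop))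
    have h₂ : J.yonedaEquiv.symm (m.hom.app U s) = J.yonedaEquiv.symm s ≫ m := h₁.symm
    rw [h₂, M.map_comp]
    rfl
  exact ⟨({ app := fun G => (f.adj.homEquiv _ _).symm (φ G)
            naturality := fun G G' m => by
              rw [← f.adj.homEquiv_naturality_left_symm, hφ]
              exact f.adj.homEquiv_naturality_right_symm _ _ } :
            f.inverseImage ⟶ g.inverseImage)⟩

theorem nonempty_iso_of_hom {f g : Geom E (OpenTopos Y)} (h : Nonempty (f ⟶ g))
    (h' : Nonempty (g ⟶ f)) : Nonempty (f ≅ g) :=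
  ⟨⟨h.some, h'.some, Subsingleton.elim _ _, Subsingleton.elim _ _⟩⟩

theorem isTerminal_inverseImage_openSheaf_top (f : Geom E (OpenTopos Y)) :
    Nonempty (IsTerminal (f.inverseImage.obj (openSheaf (⊤ : Opens Y)))) := by
  have := f.preservesFiniteLimits
  have : PreservesFiniteLimits ((Opens.grothendieckTopology Y).yoneda ⋙ f.inverseImage) :=
    comp_preservesFiniteLimits _ _
  exact ⟨(isTerminalTop : IsTerminal (⊤ : Opens Y)).isTerminalObj
    ((Opens.grothendieckTopology Y).yoneda ⋙ f.inverseImage) _⟩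

theorem nonempty_hom_inf (f : Geom E (OpenTopos Y)) {e : E} {U V : Opens Y}
    (hU : Nonempty (e ⟶ f.inverseImage.obj (openSheaf U)))
    (hV : Nonempty (e ⟶ f.inverseImage.obj (openSheaf V))) :
    Nonempty (e ⟶ f.inverseImage.obj (openSheaf (U ⊓ V))) := by
  have := f.preservesFiniteLimits
  let F : Opens Y ⥤ E := (Opens.grothendieckTopology Y).yoneda ⋙ f.inverseImage
  have hF : PreservesFiniteLimits F := comp_preservesFiniteLimits _ _
  let c : BinaryFan U V := BinaryFan.mk (homOfLE inf_le_left : U ⊓ V ⟶ U) (homOfLE inf_le_right)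
  have hc : IsLimit c := BinaryFan.isLimitMk
    (fun s => homOfLE (le_inf (leOfHom s.fst) (leOfHom s.snd)))
    (fun _ => Subsingleton.elim _ _) (fun _ => Subsingleton.elim _ _)
    (fun _ _ _ _ => Subsingleton.elim _ _)
  have := mapIsLimitOfPreservesOfIsLimit F _ _ hc
  exact ⟨BinaryFan.IsLimit.lift this hU.some hV.some⟩

theorem nonempty_hom_finset_inf (f : Geom E (OpenTopos Y)) {e : E} {ι : Type*} (T : Finset ι)
    (U : ι → Opens Y) (h : ∀ i ∈ T, Nonempty (e ⟶ f.inverseImage.obj (openSheaf (U i)))) :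
    Nonempty (e ⟶ f.inverseImage.obj (openSheaf (T.inf U))) := by
  induction T using Finset.cons_induction with
  | empty =>
    obtain ⟨hT⟩ := f.isTerminal_inverseImage_openSheaf_top
    rw [Finset.inf_empty]
    exact ⟨hT.from e⟩
  | cons a T ha ih =>
    rw [Finset.inf_cons]
    exact f.nonempty_hom_inf (h a (Finset.mem_cons_self a T))
      (ih fun i hi => h i (Finset.mem_cons_of_mem hi))

/-- The existence of morphisms from the inverse images of open sets to a subterminal object is a
local question. -/
theorem nonempty_hom_of_cover (f : Geom E (OpenTopos Y)) {e : E} (he : IsSubterminal e) {U : Opens Y}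
    (h : ∀ x ∈ U, ∃ V ≤ U, x ∈ V ∧ Nonempty (f.inverseImage.obj (openSheaf V) ⟶ e)) :
    Nonempty (f.inverseImage.obj (openSheaf U) ⟶ e) := by
  rw [(f.openEquiv U e).nonempty_congr]
  let S : Sieve U :=
    { arrows := fun V _ => Nonempty ((f.directImage.obj e).obj.obj (op V))
      downward_closed := fun h g => h.map ((f.directImage.obj e).obj.map g.op) }
  refine nonempty_of_cover (K := Opens.grothendieckTopology Y) (e := f.directImage.obj e)
    (fun V => f.subsingleton_sections he V) (T := S) (fun x hx => ?_) (fun _ _ hf => hf)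
  obtain ⟨V, hVU, hxV, hV⟩ := h x hx
  exact ⟨V, homOfLE hVU, (f.openEquiv V e).nonempty_congr.mp hV, hxV⟩

end Geom

section Continuous

variable {X Y : TopCat.{u}} (p : X ⟶ Y)

/-- The geometric morphism defined by a continuous map, between sheaves on open sets. -/
noncomputable abbrev openGeom : Geom (OpenTopos X) (OpenTopos Y) :=
  geomOfContinuous p

/-- Transpose of the identity of the preimage of `U`. With the next lemma, which uses the unit, this
replaces the isomorphism between the inverse image of `U` and its preimage. -/
theorem nonempty_inverseImage_openSheaf_hom (U : Opens Y) :
    Nonempty ((openGeom p).inverseImage.obj (openSheaf U) ⟶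
      openSheaf ((Opens.map p).obj U)) :=
  ⟨((openGeom p).openEquiv U _).symm
    (𝟙 ((Opens.map p).obj U) : (Opens.map p).obj U ⟶ (Opens.map p).obj U)⟩

theorem nonempty_hom_inverseImage_openSheaf (U : Opens Y) :
    Nonempty (openSheaf ((Opens.map p).obj U) ⟶
      (openGeom p).inverseImage.obj (openSheaf U)) :=
  ⟨(Opens.grothendieckTopology X).yonedaEquiv.symm
    ((openGeom p).openEquiv U _ (𝟙 _))⟩

end Continuous

/-! ### The localic reflection of a site. -/

section ClosedSets

variable {C : Type u} [SmallCategory C] (K : GrothendieckTopology C)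

/-- Sets of objects of a site which are stable under domains of morphisms and of a local nature;
these are the open sets of the localic reflection of the topos of sheaves. -/
@[ext]
structure LocalSet where
  /-- the underlying set of objects -/
  carrier : Set C
  down : ∀ {c d : C}, (d ⟶ c) → c ∈ carrier → d ∈ carrier
  loc : ∀ {c : C} (T : Sieve c), T ∈ K c → (∀ ⦃d : C⦄ (f : d ⟶ c), T f → d ∈ carrier) → c ∈ carrier

namespace LocalSet

variable {K}

instance : PartialOrder (LocalSet K) where
  le S T := S.carrier ⊆ T.carrier
  le_refl _ := subset_rfl
  le_trans _ _ _ := Set.Subset.trans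
  le_antisymm S T h h' := LocalSet.ext (h.antisymm h')

/-- The objects which are locally in a set stable under domains of morphisms. -/
def closure (S : Set C) (hS : ∀ {c d : C}, (d ⟶ c) → c ∈ S → d ∈ S) : LocalSet K where
  carrier := {c | ∃ T ∈ K c, ∀ ⦃d : C⦄ (f : d ⟶ c), T f → d ∈ S}
  down {c d} g := fun ⟨T, hT, h⟩ => ⟨T.pullback g, K.pullback_stable g hT, fun _ f hf => h _ hf⟩
  loc {c} T hT h := by
    let R : Sieve c :=
      { arrows := fun d _ => d ∈ S
        downward_closed := fun h g => hS g h }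
    refine ⟨R, K.transitive hT R fun d f hf => ?_, fun _ _ h => h⟩
    obtain ⟨Q, hQ, hQS⟩ := h f hf
    exact K.superset_covering (fun _ g hg => hQS g hg) hQ

theorem subset_closure (S : Set C) (hS : ∀ {c d : C}, (d ⟶ c) → c ∈ S → d ∈ S) :
    S ⊆ (closure (K := K) S hS).carrier :=
  fun _ hc => ⟨⊤, K.top_mem _, fun _ f _ => hS f hc⟩

theorem closure_subset (S : Set C) (hS : ∀ {c d : C}, (d ⟶ c) → c ∈ S → d ∈ S) (W : LocalSet K)
    (h : S ⊆ W.carrier) : closure (K := K) S hS ≤ W :=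
  fun _ ⟨T, hT, hTS⟩ => W.loc T hT fun _ f hf => h (hTS f hf)

/-- The local set generated by an object. -/
def principal (c : C) : LocalSet K :=
  closure {d | Nonempty (d ⟶ c)} (fun g h => h.map (g ≫ ·))

theorem mem_principal {c d : C} (f : d ⟶ c) : d ∈ (principal (K := K) c).carrier :=
  subset_closure {d | Nonempty (d ⟶ c)} (fun g h => h.map (g ≫ ·)) ⟨f⟩

theorem principal_le_iff {c : C} {W : LocalSet K} : principal c ≤ W ↔ c ∈ W.carrier := by
  constructor
  · exact fun h => h (mem_principal (𝟙 c))
  · exact fun h => closure_subset _ (fun g h => h.map (g ≫ ·)) _ fun d ⟨f⟩ => W.down f h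

variable (K) in
/-- The functor sending an object to the local set it generates. -/
def principalFunctor : C ⥤ LocalSet K where
  obj c := principal c
  map f := homOfLE (principal_le_iff.mpr (mem_principal f))

variable (K) in
/-- The topology on the local sets for which a family covers when its members locally exhaust the
target. -/
def topology : GrothendieckTopology (LocalSet K) where
  sieves W := {S | ∀ c ∈ W.carrier, ∃ T ∈ K c, ∀ ⦃d : C⦄ (f : d ⟶ c), T f →
    ∃ (V : LocalSet K) (i : V ⟶ W), S i ∧ d ∈ V.carrier}
  top_mem' W c hc := ⟨⊤, K.top_mem c, fun _ f _ => ⟨W, 𝟙 W, trivial, W.down f hc⟩⟩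
  pullback_stable' := by
    intro W W' S i hS c hc
    obtain ⟨T, hT, h⟩ := hS c (leOfHom i hc)
    refine ⟨T, hT, fun d f hf => ?_⟩
    obtain ⟨V, j, hj, hd⟩ := h f hf
    have hd' := W'.down f hc
    -- Both `V` and `W'` contain `d`, so `principal d` serves as a common lower bound.
    refine ⟨principal d, homOfLE (principal_le_iff.mpr hd'), ?_,
      mem_principal (𝟙 d)⟩
    have := S.downward_closed hj (homOfLE (principal_le_iff.mpr hd) : principal d ⟶ V)
    exact this
  transitive' := by
    intro W S hS R hR c hc
    obtain ⟨T, hT, h⟩ := hS c hc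
    let Q : Sieve c :=
      { arrows := fun d _ => ∃ (V : LocalSet K) (i : V ⟶ W), R i ∧ d ∈ V.carrier
        downward_closed := fun ⟨V, i, hi, hd⟩ g => ⟨V, i, hi, V.down g hd⟩ }
    refine ⟨Q, K.transitive hT Q fun d f hf => ?_, fun _ _ h => h⟩
    obtain ⟨V, i, hi, hd⟩ := h f hf
    obtain ⟨T', hT', h'⟩ := hR hi d hd
    refine K.superset_covering (fun e g hg => ?_) hT'
    obtain ⟨V', j, hj, he⟩ := h' g hg
    exact ⟨V', j ≫ i, hj, he⟩

instance : (principalFunctor K).IsCocontinuous K (topology K) where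
  cover_lift {c S} hS := by
    obtain ⟨T, hT, h⟩ := hS c (mem_principal (𝟙 c))
    refine K.superset_covering (fun d f hf => ?_) hT
    obtain ⟨V, i, hi, hd⟩ := h f hf
    exact S.downward_closed hi (homOfLE (principal_le_iff.mpr hd) : principal d ⟶ V)

end LocalSet

/-- The inverse image functor defined by a cocontinuous functor is left adjoint to the right Kan
extension. -/
noncomputable def cocontinuousAdjunction {D : Type u} [SmallCategory D] (G : C ⥤ D)
    (J : GrothendieckTopology D) [G.IsCocontinuous K J] :
    sheafToPresheaf J (Type u) ⋙ (Functor.whiskeringLeft _ _ _).obj G.op ⋙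
      presheafToSheaf K (Type u) ⊣ G.sheafPushforwardCocontinuous (Type u) K J :=
  ((G.op.ranAdjunction (Type u)).comp (sheafificationAdjunction K (Type u))).restrictFullyFaithful
    (fullyFaithfulSheafToPresheaf J (Type u)) (Functor.FullyFaithful.id _) (Iso.refl _)
    (Iso.refl _)

/-- The geometric morphism defined by a cocontinuous functor. -/
noncomputable def geomOfCocontinuous {D : Type u} [SmallCategory D] (G : C ⥤ D)
    (J : GrothendieckTopology D) [G.IsCocontinuous K J] :
    Geom (Sheaf K (Type u)) (Sheaf J (Type u)) where
  inverseImage := _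
  directImage := _
  adj := cocontinuousAdjunction K G J
  preservesFiniteLimits := by
    have : PreservesFiniteLimits ((Functor.whiskeringLeft _ _ (Type u)).obj G.op ⋙
      presheafToSheaf K (Type u)) := comp_preservesFiniteLimits _ _
    exact comp_preservesFiniteLimits _ _

/-- The geometric morphism defined by a flat continuous functor. -/
noncomputable def geomOfFlat {D : Type u} [SmallCategory D] (G : C ⥤ D)
    (J : GrothendieckTopology D) [RepresentablyFlat G] [G.IsContinuous K J] :
    Geom (Sheaf J (Type u)) (Sheaf K (Type u)) where
  inverseImage := G.sheafPullback (Type u) K J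
  directImage := G.sheafPushforwardContinuous (Type u) K J
  adj := G.sheafAdjunctionContinuous (Type u) K J
  preservesFiniteLimits := by
    have : PreservesFiniteLimits (G.op.lan : (Cᵒᵖ ⥤ Type u) ⥤ (Dᵒᵖ ⥤ Type u)) :=
      lan_preservesFiniteLimits_of_flat (Type u) G
    exact Functor.sheafPullbackConstruction.preservesFiniteLimits _ _ _ _

end ClosedSets

/-! ### From maps of opens to geometric morphisms, and back. -/

section Localic

variable {C : Type u} [SmallCategory C] {K : GrothendieckTopology C} {Y : TopCat.{u}}

theorem representablyFlat_of_inf {D : Type u} [PartialOrder D] (F : Opens Y ⥤ D)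
    (htop : ∀ d, d ≤ F.obj ⊤)
    (hinf : ∀ d U V, d ≤ F.obj U → d ≤ F.obj V → d ≤ F.obj (U ⊓ V)) : RepresentablyFlat F where
  cofiltered d :=
    { nonempty := ⟨StructuredArrow.mk (homOfLE (htop d))⟩
      cone_objs := fun a b => ⟨StructuredArrow.mk (Y := a.right ⊓ b.right)
          (homOfLE (hinf d _ _ (leOfHom a.hom) (leOfHom b.hom))),
        StructuredArrow.homMk (homOfLE inf_le_left) (Subsingleton.elim _ _),
        StructuredArrow.homMk (homOfLE inf_le_right) (Subsingleton.elim _ _), trivial⟩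
      cone_maps := fun a b f g => ⟨a, 𝟙 a, by
        obtain rfl : f = g := StructuredArrow.ext _ _ (Subsingleton.elim _ _)
        rfl⟩ }

/-- The monotone maps from the open sets of a space to the local sets of objects of a site which
preserve finite intersections and coverings. -/
structure IsLexCover (F : Opens Y → LocalSet K) : Prop where
  mono : Monotone F
  top : ∀ c, c ∈ (F ⊤).carrier
  inf : ∀ U V c, c ∈ (F U).carrier → c ∈ (F V).carrier → c ∈ (F (U ⊓ V)).carrier
  cov : ∀ (U : Opens Y) (R : Set (Opens Y)), (∀ x ∈ U, ∃ V ∈ R, V ≤ U ∧ x ∈ V) →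
    ∀ c ∈ (F U).carrier, ∃ T ∈ K c, ∀ ⦃d : C⦄ (f : d ⟶ c), T f →
      ∃ V ∈ R, V ≤ U ∧ d ∈ (F V).carrier

/-- The morphism is the composite Sh(C, K) → Sh(`LocalSet K`) → Sh(Y): `principalFunctor` is
cocontinuous, and `F` is flat and continuous. Testing against subterminal `e` is enough to identify
the inverse images of opens. -/
theorem IsLexCover.exists_geom {F : Opens Y → LocalSet K} (hF : IsLexCover F) :
    ∃ f : Geom (Sheaf K (Type u)) (OpenTopos Y),
      ∀ (U : Opens Y) (e : Sheaf K (Type u)), IsSubterminal e →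
        (Nonempty (f.inverseImage.obj (openSheaf U) ⟶ e) ↔
          ∀ c ∈ (F U).carrier, Nonempty (e.obj.obj (op c))) := by
  let G : Opens Y ⥤ LocalSet K := hF.mono.functor
  have hflat : RepresentablyFlat G := representablyFlat_of_inf G (fun d c _ => hF.top c)
    (fun d U V hU hV c hc => hF.inf U V c (hU hc) (hV hc))
  have hcont : G.IsContinuous (Opens.grothendieckTopology Y) (LocalSet.topology K) := by
    refine Functor.isContinuous_iff_coverPreserving.mpr ⟨fun {U S} hS c hc => ?_⟩
    obtain ⟨T, hT, h⟩ := hF.cov U {V | ∃ i : V ⟶ U, S i} (fun x hx => by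
      obtain ⟨V, i, hi, hxV⟩ := hS x hx
      exact ⟨V, ⟨i, hi⟩, leOfHom i, hxV⟩) c hc
    refine ⟨T, hT, fun d f hf => ?_⟩
    obtain ⟨V, ⟨i, hi⟩, -, hd⟩ := h f hf
    exact ⟨G.obj V, G.map i, Presieve.image_mem_functorPushforward _ _ hi, hd⟩
  let f₁ := geomOfCocontinuous K (LocalSet.principalFunctor K) (LocalSet.topology K)
  let f₂ := geomOfFlat (Opens.grothendieckTopology Y) G (LocalSet.topology K)
  refine ⟨f₁.comp f₂, fun U e he => ?_⟩
  have hsub := subsingleton_of_isSubterminal he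
  rw [((f₁.comp f₂).openEquiv U e).nonempty_congr]
  -- Sections over `U` of the direct image of `e` are maps `yoneda (G U) → ran e`, hence
  -- transformations to `e` from the presheaf on `C` that is inhabited exactly on `F U`.
  let adj := (LocalSet.principalFunctor K).op.ranAdjunction (Type u)
  have e₁ : (yoneda.obj (G.obj U) ⟶ (LocalSet.principalFunctor K).op.ran.obj e.obj) ≃
      (((f₁.comp f₂).directImage.obj e).obj.obj (op U)) := yonedaEquiv
  rw [← ((adj.homEquiv _ _).trans e₁).nonempty_congr]
  constructor
  · rintro ⟨φ⟩ c hc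
    exact ⟨φ.app (op c) (homOfLE (LocalSet.principal_le_iff.mpr hc) :
      LocalSet.principal c ⟶ G.obj U)⟩
  · intro h
    exact nonempty_hom_of_subsingleton hsub fun c i =>
      h c (LocalSet.principal_le_iff.mp (leOfHom (show LocalSet.principal c ⟶ G.obj U from i)))

end Localic

section Support

variable {C : Type u} [SmallCategory C] {K : GrothendieckTopology C} {Y : TopCat.{u}}

namespace LocalSet

/-- The local set of the objects on which a sheaf with at most one section has a section. -/
def support (e : Sheaf K (Type u)) (he : ∀ c : C, Subsingleton (e.obj.obj (op c))) :
    LocalSet K where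
  carrier := {c | Nonempty (e.obj.obj (op c))}
  down g h := h.map (e.obj.map g.op)
  loc _ hT h := nonempty_of_cover he hT h

/-- The sheaf with exactly one section on the objects of a local set. -/
def toSheaf (W : LocalSet K) : Sheaf K (Type u) where
  obj :=
    { obj := fun c => ULift (PLift (c.unop ∈ W.carrier))
      map := fun f => ↾fun h => ⟨⟨W.down f.unop h.down.down⟩⟩
      map_id := fun _ => by ext; exact Subsingleton.elim _ _
      map_comp := fun _ _ => by ext; exact Subsingleton.elim _ _ }
  property := by
    refine (isSheaf_iff_isSheaf_of_type _ _).mpr fun c T hT x _ => ?_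
    exact ⟨⟨⟨W.loc T hT fun d f hf => (x f hf).down.down⟩⟩, fun _ _ _ => Subsingleton.elim _ _,
      fun _ _ => Subsingleton.elim _ _⟩

theorem isSubterminal_toSheaf (W : LocalSet K) : IsSubterminal W.toSheaf :=
  isSubterminal_of_subsingleton fun c =>
    inferInstanceAs (Subsingleton (ULift (PLift (c ∈ W.carrier))))

end LocalSet

/-- The supports of the inverse images of the open sets by a geometric morphism. -/
noncomputable def Geom.openSupport (f : Geom (Sheaf K (Type u)) (OpenTopos Y)) (U : Opens Y) :
    LocalSet K :=
  LocalSet.support _ (subsingleton_of_isSubterminal (f.isSubterminal_inverseImage_openSheaf U))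

theorem Geom.mem_openSupport_iff (f : Geom (Sheaf K (Type u)) (OpenTopos Y)) (U : Opens Y) (c : C) :
    c ∈ (f.openSupport U).carrier ↔
      Nonempty ((presheafToSheaf K (Type u)).obj (yoneda.obj c) ⟶
        f.inverseImage.obj (openSheaf U)) :=
  (sectionEquiv _ c).symm.nonempty_congr

/-- Finite intersections come from left exactness. For coverings, let `W` collect the objects lying
locally in the support of a member of `R`: each such member maps to the subterminal sheaf of `W`,
hence so does `U`. -/
theorem Geom.isLexCover_openSupport (f : Geom (Sheaf K (Type u)) (OpenTopos Y)) :
    IsLexCover f.openSupport where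
  mono U V h c hc := by
    rw [f.mem_openSupport_iff] at hc ⊢
    exact hc.map (· ≫ f.inverseImage.map
      ((Opens.grothendieckTopology Y).yoneda.map (homOfLE h)))
  top c := by
    rw [f.mem_openSupport_iff]
    obtain ⟨hT⟩ := f.isTerminal_inverseImage_openSheaf_top
    exact ⟨hT.from _⟩
  inf U V c := by
    simp only [f.mem_openSupport_iff]
    exact f.nonempty_hom_inf
  cov U R hR c hc := by
    let W : LocalSet K := LocalSet.closure {d | ∃ V ∈ R, V ≤ U ∧ d ∈ (f.openSupport V).carrier}
      (fun g ⟨V, hV, hVU, h⟩ => ⟨V, hV, hVU, (f.openSupport V).down g h⟩)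
    have : Nonempty (f.inverseImage.obj (openSheaf U) ⟶ W.toSheaf) := by
      refine f.nonempty_hom_of_cover W.isSubterminal_toSheaf fun x hx => ?_
      obtain ⟨V, hV, hVU, hxV⟩ := hR x hx
      refine ⟨V, hVU, hxV, ?_⟩
      obtain ⟨φ⟩ := nonempty_hom_of_subsingleton (P := (f.inverseImage.obj (openSheaf V)).obj)
        (Q := W.toSheaf.obj) (subsingleton_of_isSubterminal W.isSubterminal_toSheaf)
        (fun d s => ⟨⟨⟨LocalSet.subset_closure _ _ ⟨V, hV, hVU, ⟨s⟩⟩⟩⟩⟩)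
      exact ⟨⟨φ⟩⟩
    exact (this.some.hom.app (op c) hc.some).down.down

end Support

/-! ### The universal property for sheaves on a site. -/

section Product

variable {C : Type u} [SmallCategory C] {K : GrothendieckTopology C}
variable {n : ℕ} {X : Fin n → TopCat.{u}}

/-- The set of all open sets is a basis. -/
theorem isBasis_univ (Y : TopCat.{u}) : Opens.IsBasis (Set.univ : Set (Opens Y)) :=
  Opens.isBasis_iff_nbhd.mpr fun {U _} hx => ⟨U, trivial, hx, le_rfl⟩

/-- The category of boxes of open sets. -/
abbrev Box (X : Fin n → TopCat.{u}) : Type u :=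
  ∀ i, BasisCat (Set.univ : Set (Opens (X i)))

/-- The topology on boxes for which a family covers when its image by a family of maps to local sets
covers. -/
def supportTopology (F : ∀ i, Opens (X i) → LocalSet K) (hF : ∀ i, IsLexCover (F i)) :
    GrothendieckTopology (Box X) where
  sieves U := {S | ∀ c, (∀ i, c ∈ (F i (U i).1).carrier) → ∃ T ∈ K c, ∀ ⦃d : C⦄ (f : d ⟶ c), T f →
    ∃ (V : Box X) (g : V ⟶ U), S g ∧ ∀ i, d ∈ (F i (V i).1).carrier}
  top_mem' U c hc := ⟨⊤, K.top_mem c, fun _ f _ => ⟨U, 𝟙 U, trivial, fun i => (F i _).down f (hc i)⟩⟩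
  pullback_stable' := by
    intro U U' S g hS c hc
    obtain ⟨T, hT, h⟩ := hS c fun i => (hF i).mono (leOfHom (g i)) (hc i)
    refine ⟨T, hT, fun d f hf => ?_⟩
    obtain ⟨V, k, hk, hd⟩ := h f hf
    let W : Box X := fun i => ⟨(V i).1 ⊓ (U' i).1, trivial⟩
    let a : W ⟶ U' := fun i => homOfLE (inf_le_right : (V i).1 ⊓ (U' i).1 ≤ (U' i).1)
    let b : W ⟶ V := fun i => homOfLE (inf_le_left : (V i).1 ⊓ (U' i).1 ≤ (V i).1)
    refine ⟨W, a, ?_, fun i => (hF i).inf _ _ _ (hd i) ((F i _).down f (hc i))⟩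
    have h : a ≫ g = b ≫ k := funext fun i => Subsingleton.elim _ _
    change S (a ≫ g)
    rw [h]
    exact S.downward_closed hk b
  transitive' := by
    intro U S hS R hR c hc
    obtain ⟨T, hT, h⟩ := hS c hc
    let Q : Sieve c :=
      { arrows := fun d _ => ∃ (V : Box X) (g : V ⟶ U), R g ∧ ∀ i, d ∈ (F i (V i).1).carrier
        downward_closed := fun ⟨V, g, hg, hd⟩ k => ⟨V, g, hg, fun i => (F i _).down k (hd i)⟩ }
    refine ⟨Q, K.transitive hT Q fun d f hf => ?_, fun _ _ h => h⟩
    obtain ⟨V, g, hg, hd⟩ := h f hf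
    obtain ⟨T', hT', h'⟩ := hR hg d hd
    refine K.superset_covering (fun e k hk => ?_) hT'
    obtain ⟨V', g', hg', he⟩ := h' k hk
    exact ⟨V', g' ≫ g, hg', he⟩

/-- As the right side is a topology, it suffices to vary one component, where `cov` for the single
map `F i` applies. -/
theorem generatedTopology_le_supportTopology (F : ∀ i, Opens (X i) → LocalSet K)
    (hF : ∀ i, IsLexCover (F i)) :
    generatedTopology (fun i => basisTopology (isBasis_univ (X i))) ≤ supportTopology F hF := by
  refine iSup_le fun i => ?_
  rintro U S ⟨R, hR, h⟩ c hc
  obtain ⟨T, hT, hTR⟩ := (hF i).cov (U i).1 {W | ∃ g : (⟨W, trivial⟩ : BasisCat Set.univ) ⟶ U i, R g}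
    (fun x hx => by
      obtain ⟨W, g, hg, hxW⟩ := hR x hx
      exact ⟨W.1, ⟨g, hg⟩, leOfHom g, hxW⟩) c (hc i)
  refine ⟨T, hT, fun d f hf => ?_⟩
  obtain ⟨W, ⟨g, hg⟩, -, hd⟩ := hTR f hf
  obtain ⟨V, k, hk, hVi, hVj⟩ := exists_update_mem R g hg
  refine ⟨V, k, h _ hk, fun j => ?_⟩
  by_cases hj : j = i
  · subst hj; rwa [hVi]
  · rw [hVj j hj]; exact (F j _).down f (hc j)

theorem exists_isLexCover_prod
    (hgen : boxTopology (fun i => isBasis_univ (X i)) =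
      generatedTopology (fun i => basisTopology (isBasis_univ (X i))))
    (F : ∀ i, Opens (X i) → LocalSet K) (hF : ∀ i, IsLexCover (F i)) :
    ∃ G : Opens (prodSpace X) → LocalSet K, IsLexCover G ∧
      ∀ i U, G ((Opens.map (prodSpaceProj X i)).obj U) = F i U := by
  have hcov : ∀ {V : Box X} {S : Sieve V}, S ∈ boxTopology (fun i => isBasis_univ (X i)) V →
      ∀ c, (∀ i, c ∈ (F i (V i).1).carrier) → ∃ T ∈ K c, ∀ ⦃d : C⦄ (f : d ⟶ c), T f →
        ∃ (W : Box X) (g : W ⟶ V), S g ∧ ∀ i, d ∈ (F i (W i).1).carrier := fun {V S} hS =>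
    generatedTopology_le_supportTopology F hF V (hgen ▸ hS)
  let A : Opens (prodSpace X) → Set C := fun U =>
    {c | ∃ V : Box X, (boxFunctor _).obj V ≤ U ∧ ∀ i, c ∈ (F i (V i).1).carrier}
  have hA : ∀ U {c d : C}, (d ⟶ c) → c ∈ A U → d ∈ A U :=
    fun U _ _ g ⟨V, hV, h⟩ => ⟨V, hV, fun i => (F i _).down g (h i)⟩
  let G : Opens (prodSpace X) → LocalSet K := fun U => LocalSet.closure (A U) (hA U)
  have hG : ∀ {U c}, c ∈ A U → c ∈ (G U).carrier := fun h => LocalSet.subset_closure _ _ h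
  have hbox : ∀ i (U : Opens (X i)), ∃ Q : Box X, (Q i).1 = U ∧ ∀ j, j ≠ i → (Q j).1 = ⊤ :=
    fun i U => ⟨fun j => ⟨Function.update (β := fun j => Opens (X j)) (fun _ => ⊤) i U j, trivial⟩,
      by simp,
      fun j hj => by simp [hj]⟩
  refine ⟨G, ⟨fun U V h => ?_, fun c => ?_, fun U V c => ?_, fun U R hR => ?_⟩, fun i U => ?_⟩
  · exact LocalSet.closure_subset _ _ _ fun c ⟨W, hW, hc⟩ => hG ⟨W, hW.trans h, hc⟩
  · exact hG ⟨fun i => ⟨⊤, trivial⟩, le_top, fun i => (hF i).top c⟩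
  · rintro ⟨T, hT, h⟩ ⟨T', hT', h'⟩
    refine ⟨T ⊓ T', K.intersection_covering hT hT', fun d f hf => ?_⟩
    obtain ⟨W, hW, hd⟩ := h f hf.1
    obtain ⟨W', hW', hd'⟩ := h' f hf.2
    exact ⟨fun i => ⟨(W i).1 ⊓ (W' i).1, trivial⟩,
      fun x hx => ⟨hW fun i hi => (hx i hi).1, hW' fun i hi => (hx i hi).2⟩,
      fun i => (hF i).inf _ _ _ (hd i) (hd' i)⟩
  · have hdown : ∀ {c d : C}, (d ⟶ c) → c ∈ {c | ∃ V ∈ R, V ≤ U ∧ c ∈ (G V).carrier} →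
        d ∈ {c | ∃ V ∈ R, V ≤ U ∧ c ∈ (G V).carrier} :=
      fun g ⟨V, hV, hVU, h⟩ => ⟨V, hV, hVU, (G V).down g h⟩
    refine LocalSet.closure_subset (A U) (hA U) (LocalSet.closure _ hdown) ?_
    rintro c ⟨V, hVU, hc⟩
    -- Boxes inside members of `R` cover `V` pointwise, hence for the generated topology, hence
    -- after applying the maps `F i`.
    let S : Sieve V :=
      { arrows := fun W _ => ∃ Q ∈ R, Q ≤ U ∧ (boxFunctor _).obj W ≤ Q
        downward_closed := fun ⟨Q, hQ, hQU, h⟩ g =>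
          ⟨Q, hQ, hQU, (leOfHom ((boxFunctor _).map g)).trans h⟩ }
    obtain ⟨T, hT, h⟩ := hcov (S := S) (fun x hx => by
      obtain ⟨Q, hQ, hQU, hxQ⟩ := hR x (hVU hx)
      obtain ⟨W, hxW, hWV, hWQ⟩ := exists_box_nhd_le (fun i => isBasis_univ (X i)) hx hxQ
      exact ⟨W, fun i => homOfLE (hWV i), ⟨Q, hQ, hQU, hWQ⟩, hxW⟩) c hc
    refine ⟨T, hT, fun d f hf => ?_⟩
    obtain ⟨W, g, ⟨Q, hQ, hQU, hWQ⟩, hd⟩ := h f hf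
    exact ⟨Q, hQ, hQU, hG ⟨W, hWQ, hd⟩⟩
  · obtain ⟨Q, hQi, hQj⟩ := hbox i U
    refine le_antisymm (LocalSet.closure_subset _ _ _ ?_) fun c hc => hG ⟨Q, fun x hx => ?_, ?_⟩
    · rintro c ⟨V, hV, hc⟩
      -- `V` may lie in the cylinder over `U` without `V i ≤ U`, when another component is empty.
      -- The boxes with `i`-th component inside `U` still cover `V`.
      let S : Sieve V :=
        { arrows := fun W _ => (W i).1 ≤ U
          downward_closed := fun h g => le_trans (Subtype.coe_le_coe.mpr (leOfHom (g i))) h }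
      obtain ⟨T, hT, h⟩ := hcov (S := S) (fun x hx =>
        ⟨fun j => ⟨(V j).1 ⊓ (Q j).1, trivial⟩, fun j => homOfLE
            (show (V j).1 ⊓ (Q j).1 ≤ (V j).1 from inf_le_left),
          show (V i).1 ⊓ (Q i).1 ≤ U from hQi ▸ inf_le_right, fun j hj => ⟨hx j hj, by
            by_cases hji : j = i
            · subst hji; rw [hQi]; exact hV hx
            · rw [hQj j hji]; trivial⟩⟩) c hc
      refine (F i U).loc T hT fun d f hf => ?_
      obtain ⟨W, g, hW, hd⟩ := h f hf
      exact (hF i).mono hW (hd i)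
    · have : x i ∈ (Q i).1 := hx i trivial
      rwa [hQi] at this
    · intro j
      by_cases hji : j = i
      · subst hji; rwa [hQi]
      · rw [hQj j hji]; exact (hF j).top c

/-- The morphism built from the product of the supports has the right support on each cylinder. By
thinness, comparison maps in both directions on opens already give an isomorphism. -/
theorem exists_geom_prodSpace
    (hgen : boxTopology (fun i => isBasis_univ (X i)) =
      generatedTopology (fun i => basisTopology (isBasis_univ (X i))))
    (f : ∀ i, Geom (Sheaf K (Type u)) (OpenTopos (X i))) :
    ∃ g : Geom (Sheaf K (Type u)) (OpenTopos (prodSpace X)),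
      ∀ i, Nonempty (g.comp (openGeom (prodSpaceProj X i)) ≅ f i) := by
  obtain ⟨G, hG, hGf⟩ := exists_isLexCover_prod hgen (fun i => (f i).openSupport)
    (fun i => (f i).isLexCover_openSupport)
  obtain ⟨g, hg⟩ := hG.exists_geom
  refine ⟨g, fun i => Geom.nonempty_iso_of_hom (Geom.nonempty_hom _ _ fun U => ?_)
    (Geom.nonempty_hom _ _ fun U => ?_)⟩
  · obtain ⟨φ⟩ := nonempty_inverseImage_openSheaf_hom (prodSpaceProj X i) U
    obtain ⟨ψ⟩ := (hg _ _ ((f i).isSubterminal_inverseImage_openSheaf U)).mpr (fun c hc => by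
      rw [hGf i U] at hc
      exact hc)
    exact ⟨g.inverseImage.map φ ≫ ψ⟩
  · obtain ⟨φ⟩ := nonempty_hom_inverseImage_openSheaf (prodSpaceProj X i) U
    have hsub := (g.comp (openGeom (prodSpaceProj X i))).isSubterminal_inverseImage_openSheaf U
    have h := (hg _ _ hsub).mp ⟨g.inverseImage.map φ⟩
    rw [hGf i U] at h
    obtain ⟨ψ⟩ := nonempty_hom_of_subsingleton
      (P := ((f i).inverseImage.obj (openSheaf U)).obj) (subsingleton_of_isSubterminal hsub)
      (fun c s => h c ⟨s⟩)
    exact ⟨⟨ψ⟩⟩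

variable {E : Type (u + 1)} [Category.{u} E]

theorem boxFunctor_obj_eq_inf (V : Box X) : (boxFunctor _).obj V =
    Finset.univ.inf fun i => (Opens.map (prodSpaceProj X i)).obj (V i).1 := by
  ext x
  rw [Opens.coe_finset_inf, Finset.inf_eq_iInf]
  simp only [Finset.mem_univ, iInf_pos, Set.iInf_eq_iInter, Set.mem_iInter]
  exact ⟨fun h i => h i trivial, fun h i _ => h i⟩

/-- Transformations between geometric morphisms to the topos of sheaves on a product space are
defined by transformations between their composites with the projections. -/
theorem nonempty_hom_of_proj (f g : Geom E (OpenTopos (prodSpace X)))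
    (h : ∀ i, Nonempty (f.comp (openGeom (prodSpaceProj X i)) ⟶
      g.comp (openGeom (prodSpaceProj X i)))) : Nonempty (f ⟶ g) := by
  refine Geom.nonempty_hom _ _ fun U =>
    f.nonempty_hom_of_cover (g.isSubterminal_inverseImage_openSheaf U) fun x hx => ?_
  obtain ⟨V, hxV, hVU⟩ := exists_box_nhd (fun i => isBasis_univ (X i)) hx
  refine ⟨_, hVU, hxV, ?_⟩
  -- A box is a finite intersection of cylinders, which `g` preserves; on each cylinder the map
  -- comes from the `i`-th projection.
  have : Nonempty (f.inverseImage.obj (openSheaf ((boxFunctor _).obj V)) ⟶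
      g.inverseImage.obj (openSheaf
        (Finset.univ.inf fun i => (Opens.map (prodSpaceProj X i)).obj (V i).1))) := by
    refine g.nonempty_hom_finset_inf _ _ fun i _ => ?_
    obtain ⟨φ⟩ := nonempty_hom_inverseImage_openSheaf (prodSpaceProj X i) (V i).1
    obtain ⟨ψ⟩ := nonempty_inverseImage_openSheaf_hom (prodSpaceProj X i) (V i).1
    obtain ⟨α⟩ := h i
    have hle : (boxFunctor _).obj V ≤ (Opens.map (prodSpaceProj X i)).obj (V i).1 :=
      fun y hy => hy i trivial
    exact ⟨f.inverseImage.map ((Opens.grothendieckTopology _).yoneda.map (homOfLE hle) ≫ φ) ≫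
      NatTrans.app (F := (f.comp (openGeom (prodSpaceProj X i))).inverseImage)
        (G := (g.comp (openGeom (prodSpaceProj X i))).inverseImage) α (openSheaf (V i).1) ≫
      g.inverseImage.map ψ⟩
  rw [← boxFunctor_obj_eq_inf] at this
  exact this.map (· ≫ g.inverseImage.map ((Opens.grothendieckTopology _).yoneda.map (homOfLE hVU)))

end Product

/-! ### Formal properties of products of toposes. -/

namespace Geom

section Formal

variable {E F G : Type (u + 1)} [Category.{u} E] [Category.{u} F] [Category.{u} G]

/-- The identity geometric morphism. -/
def identity (E : Type (u + 1)) [Category.{u} E] : Geom E E where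
  inverseImage := 𝟭 E
  directImage := 𝟭 E
  adj := Adjunction.id
  preservesFiniteLimits := inferInstance

/-- The geometric morphism whose inverse image is an equivalence of categories. -/
def ofEquivalence (e : F ≌ E) : Geom E F where
  inverseImage := e.functor
  directImage := e.inverse
  adj := e.toAdjunction
  preservesFiniteLimits := inferInstance

/-- Isomorphisms of geometric morphisms from isomorphisms of inverse images. -/
def isoMk {f g : Geom E F} (e : f.inverseImage ≅ g.inverseImage) : f ≅ g where
  hom := e.hom
  inv := e.inv
  hom_inv_id := e.hom_inv_id
  inv_hom_id := e.inv_hom_id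

/-- The isomorphism of inverse images underlying an isomorphism of geometric morphisms. -/
def inverseImageIso {f g : Geom E F} (e : f ≅ g) : f.inverseImage ≅ g.inverseImage where
  hom := e.hom
  inv := e.inv
  hom_inv_id := e.hom_inv_id
  inv_hom_id := e.inv_hom_id

/-- Precomposition with a geometric morphism preserves isomorphisms. -/
def compIsoRight (f : Geom E F) {g g' : Geom F G} (e : g ≅ g') : f.comp g ≅ f.comp g' :=
  isoMk (Functor.isoWhiskerRight (inverseImageIso e) f.inverseImage)

theorem isEquiv_of_comp_iso {f : Geom E F} {g : Geom F E} (h : f.comp g ≅ identity E)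
    (h' : g.comp f ≅ identity F) : f.IsEquiv :=
  (CategoryTheory.Equivalence.mk f.inverseImage g.inverseImage
    (inverseImageIso h').symm (inverseImageIso h)).isEquivalence_functor

end Formal

end Geom

namespace IsToposProduct

variable {n : ℕ} {F : Fin n → Type (u + 1)} [∀ i, Category.{u} (F i)]
  {P Q : Type (u + 1)} [Category.{u} P] [Category.{u} Q] {π : ∀ i, Geom P (F i)}
  {ρ : ∀ i, Geom Q (F i)}

theorem exists_geom (hπ : IsToposProduct π) {E : Type (u + 1)} [Category.{u} E] (hE : IsTopos E)
    (f : ∀ i, Geom E (F i)) : ∃ g : Geom E P, ∀ i, Nonempty (g.comp (π i) ≅ f i) := by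
  have := hπ.isEquivalence E hE
  let Φ := Functor.pi' (fun i => Geom.postcomp E (π i))
  exact ⟨Φ.objPreimage f, fun i => ⟨(Pi.eval _ i).mapIso (Φ.objObjPreimageIso f)⟩⟩

theorem nonempty_iso (hπ : IsToposProduct π) {E : Type (u + 1)} [Category.{u} E] (hE : IsTopos E)
    (f g : Geom E P) (h : ∀ i, Nonempty (f.comp (π i) ≅ g.comp (π i))) : Nonempty (f ≅ g) := by
  have := hπ.isEquivalence E hE
  let Φ := Functor.pi' (fun i => Geom.postcomp E (π i))
  let e : Φ.obj f ≅ Φ.obj g := Pi.isoMk fun i => (h i).some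
  exact ⟨Φ.preimageIso e⟩

theorem nonempty_iso_identity (hπ : IsToposProduct π) (g : Geom Q P)
    (h : Geom P Q) (hg : ∀ i, Nonempty (g.comp (π i) ≅ ρ i))
    (hh : ∀ i, Nonempty (h.comp (ρ i) ≅ π i)) : Nonempty (h.comp g ≅ Geom.identity P) := by
  refine hπ.nonempty_iso hπ.isTopos _ _ fun i => ?_
  obtain ⟨a⟩ := hg i
  obtain ⟨b⟩ := hh i
  let c : (h.comp g).comp (π i) ≅ h.comp (g.comp (π i)) := Geom.isoMk (Iso.refl _)
  let d : π i ≅ (Geom.identity P).comp (π i) := Geom.isoMk (Functor.rightUnitor _).symm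
  exact ⟨c ≪≫ h.compIsoRight a ≪≫ b ≪≫ d⟩

/-- The universal property of `ρ` gives a morphism backwards; both composites agree with identities
after projection, so uniqueness up to isomorphism makes them identities. -/
theorem isEquiv (hπ : IsToposProduct π) (hρ : IsToposProduct ρ) (g : Geom Q P)
    (hg : ∀ i, Nonempty (g.comp (π i) ≅ ρ i)) : g.IsEquiv := by
  obtain ⟨h, hh⟩ := hρ.exists_geom hπ.isTopos π
  obtain ⟨a⟩ := hπ.nonempty_iso_identity g h hg hh
  obtain ⟨b⟩ := hρ.nonempty_iso_identity h g hh hg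
  exact Geom.isEquiv_of_comp_iso b a

end IsToposProduct

/-! ### The product space gives the product topos. -/

section ProductSpace

variable {n : ℕ} {X : Fin n → TopCat.{u}}

theorem exists_geom_prodSpace_of_isTopos
    (hgen : boxTopology (fun i => isBasis_univ (X i)) =
      generatedTopology (fun i => basisTopology (isBasis_univ (X i))))
    {E : Type (u + 1)} [Category.{u} E] (hE : IsTopos E) (f : ∀ i, Geom E (OpenTopos (X i))) :
    ∃ g : Geom E (OpenTopos (prodSpace X)),
      ∀ i, Nonempty (g.comp (openGeom (prodSpaceProj X i)) ≅ f i) := by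
  obtain ⟨C, _, K, ⟨e⟩⟩ := hE
  let a : Geom (Sheaf K (Type u)) E := Geom.ofEquivalence e
  let b : Geom E (Sheaf K (Type u)) := Geom.ofEquivalence e.symm
  obtain ⟨g, hg⟩ := exists_geom_prodSpace hgen (fun i => a.comp (f i))
  refine ⟨b.comp g, fun i => ?_⟩
  obtain ⟨φ⟩ := hg i
  let c : (b.comp g).comp (openGeom (prodSpaceProj X i)) ≅
    b.comp (g.comp (openGeom (prodSpaceProj X i))) := Geom.isoMk (Iso.refl _)
  let d : b.comp (a.comp (f i)) ≅ f i :=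
    Geom.isoMk (Functor.isoWhiskerLeft (f i).inverseImage e.unitIso.symm ≪≫ Functor.rightUnitor _)
  exact ⟨c ≪≫ b.compIsoRight φ ≪≫ d⟩

theorem isToposProduct_openGeom
    (hgen : boxTopology (fun i => isBasis_univ (X i)) =
      generatedTopology (fun i => basisTopology (isBasis_univ (X i)))) :
    IsToposProduct (fun i => openGeom (prodSpaceProj X i)) where
  isTopos := ⟨Opens (prodSpace X), inferInstance, Opens.grothendieckTopology _, ⟨.refl⟩⟩
  isEquivalence E _ hE :=
    { faithful := ⟨fun {f g} _ _ _ => (Geom.quiver_isThin (Y := prodSpace X) f g).elim _ _⟩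
      full := ⟨fun {f g} β => by
        obtain ⟨α⟩ := nonempty_hom_of_proj f g (fun i => ⟨β i⟩)
        exact ⟨α, funext fun i => Subsingleton.elim (α := (f.comp _ ⟶ g.comp _)) _ _⟩⟩
      essSurj := ⟨fun f => by
        obtain ⟨g, hg⟩ := exists_geom_prodSpace_of_isTopos hgen hE f
        exact ⟨g, ⟨Pi.isoMk fun i => (hg i).some⟩⟩⟩ }

theorem isToposProduct_shProj
    (hX : ∀ i j : Fin n, ¬ IsLocCompact (X i) → ¬ IsLocCompact (X j) → i = j) :
    IsToposProduct (shProj X) :=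
  isToposProduct_openGeom (boxTopology_eq_generatedTopology _ hX)

end ProductSpace

theorem proposition3p1p13 {n : ℕ} (X : Fin n → TopCat.{u}) :
    -- all the spaces being locally compact except possibly one:
    ((∀ i j : Fin n, ¬ IsLocCompact (X i) → ¬ IsLocCompact (X j) → i = j) →
      -- the sheaf topos of the product space is a product of the sheaf toposes of the factors
      IsToposProduct (shProj X) ∧
      -- and the canonical morphism to any product of these toposes is an equivalence
      (∀ (P : Type (u + 1)) [Category.{u} P] (π : ∀ i, Geom P (ShTopos (X i))),
        IsToposProduct π →
          (∃ g : Geom (ShTopos (prodSpace X)) P, ∀ i, Nonempty (g.comp (π i) ≅ shProj X i)) ∧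
          ∀ g : Geom (ShTopos (prodSpace X)) P,
            (∀ i, Nonempty (g.comp (π i) ≅ shProj X i)) → g.IsEquiv)) ∧
    -- for all bases of open sets of the factors:
    (∀ (B : ∀ i, Set (Opens (X i))) (hB : ∀ i, Opens.IsBasis (B i)),
      -- sheaves on the product space are the sheaves on the product of the bases
      (∃ e : ShTopos (prodSpace X) ≌ Sheaf (boxTopology hB) (Type u),
        Nonempty (e.functor ⋙ sheafToPresheaf (boxTopology hB) (Type u) ≅
          sheafToPresheaf (Opens.grothendieckTopology (prodSpace X)) (Type u) ⋙
            (Functor.whiskeringLeft _ _ _).obj (boxFunctor B).op)) ∧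
      -- the topology of the product contains those induced by the factors
      (∀ i, factorTopology i (basisTopology (hB i)) ≤ boxTopology hB) ∧
      -- it is generated by them if all factors but possibly one are locally compact
      ((∀ i j : Fin n, ¬ IsLocCompact (X i) → ¬ IsLocCompact (X j) → i = j) →
        boxTopology hB = generatedTopology (fun i => basisTopology (hB i))) ∧
      -- when it is generated by them, its coverings are characterized by closed sieves
      (boxTopology hB = generatedTopology (fun i => basisTopology (hB i)) →
        ∀ (U : ∀ i, BasisCat (B i)) (R : Presieve U),
          Sieve.generate R ∈ boxTopology hB U ↔
            ∀ S : Sieve U, R ≤ S.arrows →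
              (∀ i, (factorTopology i (basisTopology (hB i))).IsClosed S) → S = ⊤)) := by
  refine ⟨fun hX => ⟨isToposProduct_shProj hX, fun P _ π hπ =>
    ⟨hπ.exists_geom (isToposProduct_shProj hX).isTopos _,
      fun g hg => hπ.isEquiv (isToposProduct_shProj hX) g hg⟩⟩, fun B hB =>
    ⟨exists_sheaf_box_equivalence hB, factorTopology_le_boxTopology hB,
      boxTopology_eq_generatedTopology hB, fun h U R => ?_⟩⟩
  rw [h]
  exact mem_iSup_iff_forall_isClosed _ R
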